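/- **Setting.** Let $d\ge 1$, $L>0$, and let $\mathcal F_L$ be the set of $f:[0,1]^d\to[0,1]$ with $|f(x)-f(y)|\le L\|x-y\|_\infty$ for all $x,y$. For a probability distribution $\mathcal D$ on $[0,1]^d\times[0,1]$ put $\mathrm{err}_{\mathcal D}(f)=\mathbb E_{(x,y)\sim\mathcal D}|y-f(x)|$ and $\mathrm{err}_{\mathcal D}(\mathcal F_L)=\inf_{f\in\mathcal F_L}\mathrm{err}_{\mathcal D}(f)$. For a finite labelled data set $T$, let $\hat f_T\in\mathcal F_L$ denote a minimizer over $\mathcal F_L$ of $\sum_{(x,y)\in T}|y-f(x)|$. **Preprocess** (accuracy parameter $\eta>0$, sizes $M,N\in\mathbb N$). Independently for each axis $j\in\{1,\dots,d\}$ draw $i_j$ uniformly from $\{0,1,\dots,\lfloor d/(2\eta)\rfloor\}$ and set $b^j_0=0$, $b^j_1=i_j\cdot\frac2L$, $b^j_2=b^j_1+\frac2L$, $b^j_3=b^j_2+\frac d{L\eta}$, and so on, adding $\frac2L$ and $\frac d{L\eta}$ alternately. The intervals $[b^j_{2k},b^j_{2k+1}]$ are called long, the intervals $[b^j_{2k+1},b^j_{2k+2}]$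 short; only the parts in $[0,1]$ matter. A long box $B$ is the intersection of $[0,1]^d$ with a product of long intervals, one for each axis and all starting in $[0,1]$; its extension box $\hat B$ is obtained by enlarging each of these intervals by $\frac1L$ on both sides and intersecting with $[0,1]^d$; the mid-shell of $B$ is the set of points of $\hat B$ that on some axis have as coordinate the midpoint of a short interval adjacent to the side of $B$ on this axis. Independently of the offsets, draw $M$ i.i.d. pairs $(x_i,y_i)\sim\mathcal D$; the unlabelled samples $x_i$ are given, each label $y_i$ is hidden until it is queried. In every long box only the first $N$ samples falling into it are kept; let $S_B$ be the set of kept samples of $B$. **Query**$(x)$. If $x$ lies in a long box $B$, query the labels of $S_B$ and output $\hat f_{S_B}(x)$. Otherwise, if $x$ lies in the extension box $\hat B$ of a long box $B$, query the labels of $S_B$ and output $g(x)$, where $g:\hat B\to[0,1]$ is an $L$-Lipschitz (for $\|\cdot\|_\infty$) extension of $\hat f_{S_B}|_B$ with $g=1$ on the mid-shell of $B$. Otherwise output $1$ without a label query. The choices of the minimizers (as a function of the labelled data set) and of the extensions (as a function of the offsets, the box and the function to be extended) are fixed in advance but otherwise arbitrary. **Theorem.** There is an absolute constant $c\in(0,1]$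 such that for every $\varepsilon_0<1$ there are constants $C_1,C_2>0$, depending on $\varepsilon_0$ only, with the following property. Let $d\ge1$, $0<\varepsilon\le\varepsilon_0$ and $L\ge\varepsilon$, and run the algorithm with $\eta=c\,\varepsilon$, $$M=\Big\lfloor\Big(\frac{C_1L}{\varepsilon}\Big)^d\frac1{\varepsilon^3}\log\frac1\varepsilon\Big\rfloor,\qquad N=\Big\lfloor\frac1{\varepsilon^2}\Big(\frac{C_2d}{\varepsilon^2}\Big)^d\log\frac1\varepsilon\Big\rfloor .$$ Then: 1. Minimizers $\hat f_T$ and extensions $g$ as required exist. 2. For all offsets, all samples and every $x\in[0,1]^d$, Query$(x)$ queries at most $\frac1{\varepsilon^2}\big(\frac{C_2d}{\varepsilon^2}\big)^d\log\frac1\varepsilon$ labels. The set of queried samples is determined by $x$, the offsets and the unlabelled samples, and the output depends on no label outside it. 3. For every distribution $\mathcal D$ there is an event $E$ of probability greater than $\frac12$ (over the offsets and the sample) such that, for every outcome and all choices of minimizers and extensions, there is $\tilde f\in\mathcal F_L$ with Query$(x)=\tilde f(x)$ for all $x\in[0,1]^d$, and, if the outcome lies in $E$, $\mathrm{err}_{\mathcal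 D}(\tilde f)-\mathrm{err}_{\mathcal D}(\mathcal F_L)\le\varepsilon$. -/

import Mathlib

open MeasureTheory

namespace LocalLipschitz

noncomputable section

/-- The domain `[0,1]^d`. Its metric is the product metric, i.e. the `ℓ∞` distance. -/
abbrev Cube (d : ℕ) : Type := Fin d → unitInterval

/-- The class `F_L` of functions `[0,1]^d → [0,1]` that are `L`-Lipschitz for `ℓ∞`. -/
def lipClass (d : ℕ) (L : ℝ) : Set (Cube d → ℝ) :=
  {f | (∀ x, f x ∈ Set.Icc (0 : ℝ) 1) ∧ ∀ x y, |f x - f y| ≤ L * dist x y}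

/-- Prediction error `E |y - f x|` under the distribution `D` of `(x, y)`. -/
def err {d : ℕ} (D : Measure (Cube d × unitInterval)) (f : Cube d → ℝ) : ℝ :=
  ∫ p, |(p.2 : ℝ) - f p.1| ∂D

/-- Optimal prediction error of the class `F_L`. -/
def errOpt {d : ℕ} (D : Measure (Cube d × unitInterval)) (L : ℝ) : ℝ :=
  sInf (err D '' lipClass d L)

/-- Empirical error of `f` on a finite labelled data set (with multiplicities). -/
def empErr {d : ℕ} (T : Multiset (Cube d × unitInterval)) (f : Cube d → ℝ) : ℝ :=
  (T.map fun p => |(p.2 : ℝ) - f p.1|).sum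

/-- `f` is an empirical risk minimizer on `T` within the class `F_L`. -/
def IsERM {d : ℕ} (L : ℝ) (T : Multiset (Cube d × unitInterval)) (f : Cube d → ℝ) : Prop :=
  f ∈ lipClass d L ∧ ∀ g ∈ lipClass d L, empErr T f ≤ empErr T g

/-! ### The random partition

`η` is the accuracy parameter handed to the algorithm. -/

/-- Offsets along each axis are drawn from `{0, 1, …, d/(2η)} · 2/L`. -/
def offsetMax (d : ℕ) (η : ℝ) : ℕ := ⌊(d : ℝ) / (2 * η)⌋₊

/-- One offset index per axis. -/
abbrev Offset (d : ℕ) (η : ℝ) : Type := Fin d → Fin (offsetMax d η + 1)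

/-- The boundary points `b₀ = 0, b₁ = i · 2/L, b₂ = b₁ + 2/L, b₃ = b₂ + d/(Lη), …` along an axis
with offset index `i`. The sequence is continued past `1`; only the part inside `[0,1]` matters,
and the last interval meeting `[0,1]` is cut off at `1`.
The intervals `[b_{2k}, b_{2k+1}]` are long, the intervals `[b_{2k+1}, b_{2k+2}]` are short. -/
def breakpoint (d : ℕ) (L η : ℝ) (i : ℕ) : ℕ → ℝ
  | 0 => 0
  | 1 => i * (2 / L)
  | n + 2 => breakpoint d L η i (n + 1) + if Even n then 2 / L else d / (L * η)

/-- The long box with index `J`: the product over the axes of the `J j`-th long intervals. -/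
def longBox {d : ℕ} (L η : ℝ) (o : Offset d η) (J : Fin d → ℕ) : Set (Cube d) :=
  {x | ∀ j, breakpoint d L η (o j) (2 * J j) ≤ x j ∧
    (x j : ℝ) ≤ breakpoint d L η (o j) (2 * J j + 1)}

/-- `J` is the index of a long box of the partition of `[0,1]^d`: all its intervals start in
`[0,1]`. -/
def IsBoxIndex {d : ℕ} (L η : ℝ) (o : Offset d η) (J : Fin d → ℕ) : Prop :=
  ∀ j, breakpoint d L η (o j) (2 * J j) ≤ 1

/-- The extension box: the long box with a shell of thickness `1/L`, cut off at the boundary of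
`[0,1]^d`. -/
def extBox {d : ℕ} (L η : ℝ) (o : Offset d η) (J : Fin d → ℕ) : Set (Cube d) :=
  {x | ∀ j, breakpoint d L η (o j) (2 * J j) - 1 / L ≤ x j ∧
    (x j : ℝ) ≤ breakpoint d L η (o j) (2 * J j + 1) + 1 / L}

/-- The points of the extension box which, along some axis, lie in the middle of one of the two
short intervals adjacent to the `J j`-th long interval. -/
def midShell {d : ℕ} (L η : ℝ) (o : Offset d η) (J : Fin d → ℕ) : Set (Cube d) :=
  {x | x ∈ extBox L η o J ∧ ∃ j,
    (x j : ℝ) = (breakpoint d L η (o j) (2 * J j + 1) + breakpoint d L η (o j) (2 * J j + 2)) / 2 ∨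
    (0 < J j ∧
      (x j : ℝ) = (breakpoint d L η (o j) (2 * J j - 1) + breakpoint d L η (o j) (2 * J j)) / 2)}

/-- On the extension box, `g` is an `L`-Lipschitz `[0,1]`-valued extension of the restriction of
`f` to the long box, constrained to be `1` on the mid-shell. -/
def IsShellExtension {d : ℕ} (L η : ℝ) (o : Offset d η) (J : Fin d → ℕ) (f g : Cube d → ℝ) :
    Prop :=
  (∀ x ∈ longBox L η o J, g x = f x) ∧
  (∀ x ∈ midShell L η o J, g x = 1) ∧
  (∀ x ∈ extBox L η o J, g x ∈ Set.Icc (0 : ℝ) 1) ∧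
  (∀ x ∈ extBox L η o J, ∀ y ∈ extBox L η o J, |g x - g y| ≤ L * dist x y)

/-- The choices that the description of the query algorithm leaves open: which empirical risk
minimizer and which constrained Lipschitz extension is taken. -/
structure Choices (d : ℕ) (L η : ℝ) where
  /-- the selected empirical risk minimizer on a labelled data set -/
  erm : Multiset (Cube d × unitInterval) → Cube d → ℝ
  erm_spec : ∀ T, IsERM L T (erm T)
  /-- the selected extension of a function from a long box to its extension box -/
  ext : Offset d η → (Fin d → ℕ) → (Cube d → ℝ) → Cube d → ℝ
  ext_spec : ∀ o J f, IsBoxIndex L η o J → f ∈ lipClass d L →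
    IsShellExtension L η o J f (ext o J f)

/-! ### The query algorithm

`xs` is the pool of `M` unlabelled samples, `ys` are their labels, and at most the first `N`
samples falling into a long box are kept, the later ones being discarded. -/

open Classical in
/-- The indices of the samples kept in the long box `J`. -/
def kept {d M : ℕ} (L η : ℝ) (N : ℕ) (o : Offset d η) (xs : Fin M → Cube d) (J : Fin d → ℕ) :
    Finset (Fin M) :=
  Finset.univ.filter fun i => xs i ∈ longBox L η o J ∧
    (Finset.univ.filter fun i' => i' < i ∧ xs i' ∈ longBox L η o J).card < N

/-- The labelled data set `S ∩ B_J`. -/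
def boxData {d M : ℕ} (L η : ℝ) (N : ℕ) (o : Offset d η) (xs : Fin M → Cube d)
    (ys : Fin M → unitInterval) (J : Fin d → ℕ) : Multiset (Cube d × unitInterval) :=
  (kept L η N o xs J).val.map fun i => (xs i, ys i)

open Classical in
/-- The samples whose labels are requested when the query point is `x`. -/
def labelQueries {d M : ℕ} (L η : ℝ) (N : ℕ) (o : Offset d η) (xs : Fin M → Cube d)
    (x : Cube d) : Finset (Fin M) :=
  if h : ∃ J, x ∈ longBox L η o J then kept L η N o xs h.choose
  else if h : ∃ J, IsBoxIndex L η o J ∧ x ∈ extBox L η o J then kept L η N o xs h.choose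
  else ∅

open Classical in
/-- The answer of the query algorithm at `x`. -/
def query {d M : ℕ} {L η : ℝ} (A : Choices d L η) (N : ℕ) (o : Offset d η)
    (xs : Fin M → Cube d) (ys : Fin M → unitInterval) (x : Cube d) : ℝ :=
  if h : ∃ J, x ∈ longBox L η o J then A.erm (boxData L η N o xs ys h.choose) x
  else if h : ∃ J, IsBoxIndex L η o J ∧ x ∈ extBox L η o J then
    A.ext o h.choose (A.erm (boxData L η N o xs ys h.choose)) x
  else 1

/-! ### Sample sizes and randomness -/

/-- The bound `(C L / ε)^d · (1/ε³) · log (1/ε)` on the number of unlabelled samples. -/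
def poolBound (C : ℝ) (d : ℕ) (L ε : ℝ) : ℝ :=
  (C * L / ε) ^ d * (1 / ε ^ 3) * Real.log (1 / ε)

/-- The bound `(1/ε²) · (C d / ε²)^d · log (1/ε)` on the number of label queries. -/
def labelBound (C : ℝ) (d : ℕ) (ε : ℝ) : ℝ :=
  1 / ε ^ 2 * (C * d / ε ^ 2) ^ d * Real.log (1 / ε)

/-- The joint law of the preprocessing output and the (hidden) labels: independent uniform offset
indices along the axes and, independently, `M` i.i.d. draws `(x_i, y_i)` from `D`. -/
def runLaw {d : ℕ} (η : ℝ) (M : ℕ) (D : Measure (Cube d × unitInterval)) :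
    Measure (Offset d η × (Fin M → Cube d × unitInterval)) :=
  (Measure.pi fun _ : Fin d => (PMF.uniformOfFintype (Fin (offsetMax d η + 1))).toMeasure).prod
    (Measure.pi fun _ : Fin M => D)

end

end LocalLipschitz

open LocalLipschitz

open scoped ENNReal

/-! Consistency of the answers. Enlarging every long interval by `1/L` on each side exactly exhausts
a short interval of length `2/L`, so two extension boxes meet only inside both mid-shells, where
both extensions equal `1`. A path leaving an extension box crosses its mid-shell, so an answer at
distance `r` from a point outside the box is at least `1 - L * r`. Two points without a common
extension box therefore both have answers in `[1 - L * r, 1]`, with `r` their distance, and the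
Lipschitz bound holds across boxes (`query_mem_lipClass`).

Accuracy. Points in no long box cost at most their mass. For distinct offsets of one axis the short
regions are disjoint, so a random offset makes that mass at most `2 * η` on average
(`lintegral_outside_le`).

In a long box `B` of mass `p`, the minimizer must be compared with all of `F_L` at once. No net of
functions and no union bound is used. Up to a small error, a Lipschitz `f` is constant on the cells
of a fine grid and labels are rounded to `T` levels; the loss is then a combination, with
coefficients in `{-1, 0, 1}` divided by `T`, of indicators of cells and of their parts above a label
level. One random quantity, `cellDeviation`, thus controls the deviation for every `f`
(`abs_deviation_le_cellDeviation`). Keeping only the first `N` hits is a predictable selection, so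
the centred terms are orthogonal and the second moment is explicit (`integral_sq_sum_adapted`).
Cauchy-Schwarz over the cells bounds the expectation.

A minimizer on the sample then has an excess in `B` bounded by the deviations and by the fluctuation
of the number of hits (`setIntegral_sub_le`). Summed over the disjoint boxes, with `∑ √p ≤ √(number
of boxes)`, the expected total excess is at most `ε / 4`, and Markov's inequality yields the event.
The bound involves neither the competitor nor the choices of minimizers and extensions, so one event
serves all of them. -/

namespace LocalLipschitz

/-! ### Long boxes, extension boxes and mid-shells. -/

section Geometry

variable {d : ℕ} {L η : ℝ}

theorem breakpoint_even_succ (i k : ℕ) :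
    breakpoint d L η i (2 * k + 2) = breakpoint d L η i (2 * k + 1) + 2 / L := by
  rw [breakpoint, if_pos (even_two_mul k)]

theorem breakpoint_odd_succ (i k : ℕ) :
    breakpoint d L η i (2 * k + 3) = breakpoint d L η i (2 * k + 2) + d / (L * η) := by
  rw [breakpoint, if_neg (by simp)]

theorem breakpoint_odd (i k : ℕ) :
    breakpoint d L η i (2 * k + 1) = i * (2 / L) + k * (2 / L + d / (L * η)) := by
  induction k with
  | zero => simp [breakpoint]
  | succ k ih =>
    rw [show 2 * (k + 1) + 1 = 2 * k + 3 by ring, breakpoint_odd_succ, breakpoint_even_succ, ih]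
    push_cast
    ring

theorem breakpoint_even (i k : ℕ) :
    breakpoint d L η i (2 * k + 2) = i * (2 / L) + k * (2 / L + d / (L * η)) + 2 / L := by
  rw [breakpoint_even_succ, breakpoint_odd]

theorem breakpoint_mono (hL : 0 < L) (hη : 0 < η) (i : ℕ) : Monotone (breakpoint d L η i) := by
  refine monotone_nat_of_le_succ fun n => ?_
  match n with
  | 0 => simp only [breakpoint]; positivity
  | n + 1 =>
    rw [breakpoint]
    split_ifs
    · linarith [show 0 ≤ 2 / L by positivity]
    · linarith [show 0 ≤ d / (L * η) by positivity]

theorem breakpoint_separated (hL : 0 < L) (hη : 0 < η) (i : ℕ) {k k' : ℕ} (h : k < k') :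
    breakpoint d L η i (2 * k + 1) + 2 / L ≤ breakpoint d L η i (2 * k') := by
  rw [← breakpoint_even_succ]
  exact breakpoint_mono hL hη i (by omega)

theorem longBox_subset_extBox (hL : 0 < L) (o : Offset d η) (J : Fin d → ℕ) :
    longBox L η o J ⊆ extBox L η o J := by
  intro x hx j
  have := hx j
  have h : 0 < 1 / L := by positivity
  constructor <;> linarith

theorem mid_right (i k : ℕ) :
    (breakpoint d L η i (2 * k + 1) + breakpoint d L η i (2 * k + 2)) / 2 =
      breakpoint d L η i (2 * k + 1) + 1 / L := by
  rw [breakpoint_even_succ]; ring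

theorem mid_left (i : ℕ) {k : ℕ} (hk : 0 < k) :
    (breakpoint d L η i (2 * k - 1) + breakpoint d L η i (2 * k)) / 2 =
      breakpoint d L η i (2 * k) - 1 / L := by
  obtain ⟨n, rfl⟩ : ∃ n, k = n + 1 := ⟨k - 1, by omega⟩
  rw [show 2 * (n + 1) - 1 = 2 * n + 1 by omega, show 2 * (n + 1) = 2 * n + 2 by ring,
    breakpoint_even_succ]
  ring

theorem mem_midShell_iff (o : Offset d η) (J : Fin d → ℕ) (x : Cube d) :
    x ∈ midShell L η o J ↔ x ∈ extBox L η o J ∧ ∃ j,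
      (x j : ℝ) = breakpoint d L η (o j) (2 * J j + 1) + 1 / L ∨
      (0 < J j ∧ (x j : ℝ) = breakpoint d L η (o j) (2 * J j) - 1 / L) := by
  refine and_congr_right fun _ => exists_congr fun j => or_congr ?_ (and_congr_right fun h => ?_)
  · rw [mid_right]
  · rw [mid_left _ h]

/-- On one axis the point is `1/L` beyond the box, and the `ℓ∞` distance dominates. This is what
makes the value `1` on the mid-shell compatible with any `[0,1]`-valued function on the box. -/
theorem one_div_le_dist_of_mem_midShell {o : Offset d η} {J : Fin d → ℕ}
    {x y : Cube d} (hx : x ∈ midShell L η o J) (hy : y ∈ longBox L η o J) :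
    1 / L ≤ dist x y := by
  rw [mem_midShell_iff] at hx
  obtain ⟨-, j, hj⟩ := hx
  refine le_trans ?_ (dist_le_pi_dist x y j)
  rw [Subtype.dist_eq, Real.dist_eq]
  have := hy j
  rcases hj with hj | ⟨-, hj⟩
  · exact le_trans (by linarith) (le_abs_self _)
  · exact le_trans (by linarith) (neg_le_abs _)

/-- On an axis where the indices differ, the two margins of `1/L` have to bridge a gap of at least
`2/L`, so a common point must lie exactly at the midpoint. -/
theorem mem_midShell_of_mem_extBox_of_ne (hL : 0 < L) (hη : 0 < η) {o : Offset d η}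
    {J J' : Fin d → ℕ} (hJ : J ≠ J') {x : Cube d} (hx : x ∈ extBox L η o J)
    (hx' : x ∈ extBox L η o J') : x ∈ midShell L η o J := by
  rw [mem_midShell_iff]
  obtain ⟨j, hj⟩ := Function.ne_iff.1 hJ
  have h1 := hx j
  have h2 := hx' j
  have h3 : 2 / L = 1 / L + 1 / L := by ring
  refine ⟨hx, j, ?_⟩
  rcases lt_or_gt_of_ne hj with h | h
  · have := breakpoint_separated (d := d) hL hη (o j) h
    left
    linarith
  · have := breakpoint_separated (d := d) hL hη (o j) h
    right
    exact ⟨by omega, by linarith⟩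

theorem eq_of_mem_longBox_of_mem_extBox (hL : 0 < L) (hη : 0 < η) {o : Offset d η}
    {J J' : Fin d → ℕ} {x : Cube d} (hx : x ∈ longBox L η o J)
    (hx' : x ∈ extBox L η o J') : J = J' := by
  by_contra h
  have h1 := one_div_le_dist_of_mem_midShell
    (mem_midShell_of_mem_extBox_of_ne hL hη h (longBox_subset_extBox hL o J hx) hx') hx
  rw [dist_self] at h1
  have : 0 < 1 / L := by positivity
  linarith

theorem isBoxIndex_of_mem_longBox {o : Offset d η} {J : Fin d → ℕ} {x : Cube d}
    (hx : x ∈ longBox L η o J) : IsBoxIndex L η o J :=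
  fun j => (hx j).1.trans (x j).2.2

/-- Clamp `y` coordinatewise to the extension box. The clamped point lies between `x` and `y` on
every axis, and on an axis where `y` leaves the box it sits on a face, which is the midpoint of a
short interval. -/
theorem exists_mem_midShell_dist_le (hL : 0 < L) {o : Offset d η} {J : Fin d → ℕ}
    {x y : Cube d} (hx : x ∈ extBox L η o J) (hy : y ∉ extBox L η o J) :
    ∃ z ∈ midShell L η o J, dist x z ≤ dist x y := by
  set lo : Fin d → ℝ := fun j => breakpoint d L η (o j) (2 * J j) - 1 / L
  set hi : Fin d → ℝ := fun j => breakpoint d L η (o j) (2 * J j + 1) + 1 / L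
  have hxlo : ∀ j, lo j ≤ x j := fun j => (hx j).1
  have hxhi : ∀ j, (x j : ℝ) ≤ hi j := fun j => (hx j).2
  have h0 : ∀ j, 0 ≤ max (lo j) (min (hi j) (y j)) := fun j =>
    le_max_of_le_right (le_min ((x j).2.1.trans (hxhi j)) (y j).2.1)
  have h1 : ∀ j, max (lo j) (min (hi j) (y j)) ≤ 1 := fun j =>
    max_le ((hxlo j).trans (x j).2.2) (min_le_of_right_le (y j).2.2)
  set z : Cube d := fun j => ⟨max (lo j) (min (hi j) (y j)), h0 j, h1 j⟩ with hz
  have hzv : ∀ j, (z j : ℝ) = max (lo j) (min (hi j) (y j)) := fun j => rfl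
  have hze : z ∈ extBox L η o J := fun j =>
    ⟨le_max_left _ _, max_le ((hxlo j).trans (hxhi j)) (min_le_left _ _)⟩
  refine ⟨z, (mem_midShell_iff o J z).2 ⟨hze, ?_⟩, ?_⟩
  · have : ∃ j, ¬ (lo j ≤ y j ∧ (y j : ℝ) ≤ hi j) := by
      by_contra hc
      push Not at hc
      exact hy hc
    obtain ⟨j, hj⟩ := this
    refine ⟨j, ?_⟩
    by_cases hl : lo j ≤ y j
    · have hh : hi j < y j := by
        by_contra hc
        exact hj ⟨hl, not_lt.1 hc⟩
      left
      rw [hzv, min_eq_left hh.le, max_eq_right ((hxlo j).trans (hxhi j))]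
    · have hl' : (y j : ℝ) < lo j := not_le.1 hl
      right
      refine ⟨?_, ?_⟩
      -- The first long interval starts at `0`, so no `y` in the cube can leave its enlargement
      -- downwards.
      · rcases Nat.eq_zero_or_pos (J j) with h | h
        · have h2 : lo j = 0 - 1 / L := by simp [lo, h, breakpoint]
          have h3 : 0 < 1 / L := by positivity
          have := (y j).2.1
          linarith
        · exact h
      · rw [hzv, max_eq_left ((min_le_right _ _).trans hl'.le)]
  · refine (dist_pi_le_iff dist_nonneg).2 fun j => le_trans ?_ (dist_le_pi_dist x y j)
    rw [Subtype.dist_eq, Real.dist_eq, Subtype.dist_eq, Real.dist_eq, hzv]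
    have := hxlo j
    have := hxhi j
    rcases le_total (x j : ℝ) (y j) with h | h
    · have h4 : max (lo j) (min (hi j) (y j)) ≤ y j :=
        max_le (by linarith) (min_le_right _ _)
      have h5 : (x j : ℝ) ≤ max (lo j) (min (hi j) (y j)) :=
        le_max_of_le_right (le_min (by linarith) h)
      rw [abs_of_nonpos (by linarith), abs_of_nonpos (by linarith)]
      linarith
    · have h4 : max (lo j) (min (hi j) (y j)) ≤ x j :=
        max_le (by linarith) (min_le_of_right_le h)
      have h5 : (y j : ℝ) ≤ max (lo j) (min (hi j) (y j)) :=
        le_max_of_le_right (le_min (by linarith) le_rfl)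
      rw [abs_of_nonneg (by linarith), abs_of_nonneg (by linarith)]
      linarith

/-- The prescribed values on box and mid-shell are jointly `L`-Lipschitz, since values in `[0,1]`
may differ freely at distance `1/L`. Extend from the union to the whole cube and truncate to
`[0,1]`. -/
theorem exists_isShellExtension (hL : 0 < L) (o : Offset d η) (J : Fin d → ℕ)
    {f : Cube d → ℝ} (hf : f ∈ lipClass d L) : ∃ g, IsShellExtension L η o J f g := by
  classical
  set h : Cube d → ℝ := fun x => if x ∈ longBox L η o J then f x else 1 with hh
  have hmid : ∀ x ∈ midShell L η o J, x ∉ longBox L η o J := fun x hx hx' => by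
    have h1 := one_div_le_dist_of_mem_midShell hx hx'
    rw [dist_self] at h1
    have : 0 < 1 / L := by positivity
    linarith
  have key : ∀ x ∈ midShell L η o J, ∀ y ∈ longBox L η o J, |1 - f y| ≤ L * dist x y := by
    intro x hx y hy
    have h1 := one_div_le_dist_of_mem_midShell hx hy
    have h2 := hf.1 y
    have h3 : L * (1 / L) ≤ L * dist x y := by gcongr
    rw [mul_one_div_cancel hL.ne'] at h3
    rw [abs_of_nonneg (by linarith [h2.2])]
    linarith [h2.1]
  have hlip : LipschitzOnWith L.toNNReal h (longBox L η o J ∪ midShell L η o J) := by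
    refine LipschitzOnWith.of_dist_le_mul fun x hx y hy => ?_
    rw [Real.coe_toNNReal _ hL.le, Real.dist_eq]
    rcases hx with hx | hx <;> rcases hy with hy | hy
    · simpa [hh, hx, hy] using hf.2 x y
    · simpa [hh, hx, hmid y hy, abs_sub_comm, dist_comm] using key y hy x hx
    · simpa [hh, hmid x hx, hy] using key x hx y hy
    · simp only [hh, hmid x hx, hmid y hy, if_false, sub_self, abs_zero]
      positivity
  obtain ⟨g, hg, hgh⟩ := hlip.extend_real
  have hval : ∀ x ∈ longBox L η o J ∪ midShell L η o J, max (min (g x) 1) 0 = h x := by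
    intro x hx
    rw [← hgh hx]
    have : h x ∈ Set.Icc (0 : ℝ) 1 := by
      simp only [hh]
      split_ifs
      · exact hf.1 x
      · simp
    rw [min_eq_left this.2, max_eq_left this.1]
  refine ⟨fun x => max (min (g x) 1) 0, fun x hx => ?_, fun x hx => ?_, fun x _ => ?_,
    fun x _ y _ => ?_⟩
  · exact (hval x (Or.inl hx)).trans (if_pos hx)
  · exact (hval x (Or.inr hx)).trans (if_neg (hmid x hx))
  · exact ⟨le_max_right _ _, max_le (min_le_right _ _) zero_le_one⟩
  · have h1 : |g x - g y| ≤ L * dist x y := by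
      have := hg.dist_le_mul x y
      rwa [Real.coe_toNNReal _ hL.le, Real.dist_eq] at this
    refine (abs_max_sub_max_le_abs _ _ _).trans (le_trans ?_ h1)
    simpa using abs_min_sub_min_le_max (g x) 1 (g y) 1

end Geometry

/-! ### Existence of the choices, label count and consistency of the answers. -/

section Algorithm

variable {d : ℕ} {L η : ℝ}

theorem zero_mem_lipClass (hL : 0 ≤ L) : (fun _ => 0) ∈ lipClass d L :=
  ⟨fun _ => by simp, fun x y => by simpa using mul_nonneg hL dist_nonneg⟩

/-- The topology is pointwise convergence: a closed subset of a product of intervals. It suffices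
for minimizers, because the empirical error involves finitely many values of `f`. -/
theorem isCompact_lipClass (d : ℕ) (L : ℝ) : IsCompact (lipClass d L) := by
  have h1 : IsCompact (Set.univ.pi fun _ : Cube d => Set.Icc (0 : ℝ) 1) :=
    isCompact_univ_pi fun _ => isCompact_Icc
  refine h1.of_isClosed_subset ?_ fun f hf x _ => hf.1 x
  have : lipClass d L = (⋂ x, {f : Cube d → ℝ | f x ∈ Set.Icc (0 : ℝ) 1}) ∩
      ⋂ x, ⋂ y, {f : Cube d → ℝ | |f x - f y| ≤ L * dist x y} := by
    ext f
    simp [lipClass]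
  rw [this]
  refine (isClosed_iInter fun x => isClosed_Icc.preimage (continuous_apply x)).inter
    (isClosed_iInter fun x => isClosed_iInter fun y => isClosed_le ?_ continuous_const)
  exact ((continuous_apply x).sub (continuous_apply y)).abs

theorem continuous_empErr (T : Multiset (Cube d × unitInterval)) : Continuous (empErr T) := by
  induction T using Multiset.induction with
  | empty =>
    have : empErr (0 : Multiset (Cube d × unitInterval)) = fun _ => 0 := by
      ext f
      simp [empErr]
    rw [this]
    exact continuous_const
  | cons p T ih =>
    have : empErr (p ::ₘ T) = fun f => |(p.2 : ℝ) - f p.1| + empErr T f := by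
      ext f
      simp [empErr]
    rw [this]
    exact (continuous_const.sub (continuous_apply p.1)).abs.add ih

theorem exists_isERM (hL : 0 ≤ L) (T : Multiset (Cube d × unitInterval)) :
    ∃ f, IsERM L T f := by
  obtain ⟨f, hf, hmin⟩ := (isCompact_lipClass d L).exists_isMinOn ⟨_, zero_mem_lipClass hL⟩
    (continuous_empErr T).continuousOn
  exact ⟨f, hf, fun g hg => hmin hg⟩

theorem nonempty_choices (hL : 0 < L) : Nonempty (Choices d L η) := by
  classical
  exact ⟨{ erm := fun T => (exists_isERM hL.le T).choose
           erm_spec := fun T => (exists_isERM hL.le T).choose_spec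
           ext := fun o J f =>
             -- The default `f` is irrelevant, as the specification concerns only members of the
             -- class.
             if hf : f ∈ lipClass d L then (exists_isShellExtension hL o J hf).choose else f
           ext_spec := fun o J f _ hf => by
             rw [dif_pos hf]
             exact (exists_isShellExtension hL o J hf).choose_spec }⟩

open Classical in
/-- The indices of the first `N` entries of the sequence `z` that lie in `B`. -/
noncomputable def firstHits {Z : Type*} {M : ℕ} (B : Set Z) (N : ℕ) (z : Fin M → Z) :
    Finset (Fin M) :=
  Finset.univ.filter fun i => z i ∈ B ∧
    (Finset.univ.filter fun i' => i' < i ∧ z i' ∈ B).card < N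

-- Induction on the maximum: a new last element does not change the ranks of the others, and its own
-- rank is their number.
open Classical in
theorem card_filter_card_lt {ι : Type*} [LinearOrder ι] (N : ℕ) (H : Finset ι) :
    (H.filter fun i => (H.filter fun i' => i' < i).card < N).card = min N H.card := by
  induction H using Finset.induction_on_max with
  | empty => simp
  | insert a s hs ih =>
    have ha : a ∉ s := fun h => lt_irrefl _ (hs a h)
    have h1 : (insert a s).filter (fun i' => i' < a) = s := by
      rw [Finset.filter_insert, if_neg (lt_irrefl a), Finset.filter_true_of_mem hs]
    have h2 : s.filter (fun i => ((insert a s).filter fun i' => i' < i).card < N) =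
        s.filter (fun i => (s.filter fun i' => i' < i).card < N) := by
      refine Finset.filter_congr fun i hi => ?_
      rw [Finset.filter_insert, if_neg (hs i hi).not_gt]
    rw [Finset.filter_insert, h1, h2, Finset.card_insert_of_notMem ha]
    split_ifs with h
    · rw [Finset.card_insert_of_notMem (by simp [ha]), ih]
      omega
    · rw [ih]
      omega

open Classical in
theorem card_firstHits {Z : Type*} {M : ℕ} (B : Set Z) (N : ℕ) (z : Fin M → Z) :
    (firstHits B N z).card = min N (Finset.univ.filter fun i => z i ∈ B).card := by
  rw [← card_filter_card_lt, firstHits, Finset.filter_filter]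
  congr 1
  ext i
  simp only [Finset.mem_filter, Finset.mem_univ, true_and, Finset.filter_filter, and_comm]

theorem card_firstHits_le {Z : Type*} {M : ℕ} (B : Set Z) (N : ℕ) (z : Fin M → Z) :
    (firstHits B N z).card ≤ N := by
  rw [card_firstHits]
  exact min_le_left _ _

theorem card_labelQueries_le {M : ℕ} (N : ℕ) (o : Offset d η) (xs : Fin M → Cube d)
    (x : Cube d) : (labelQueries L η N o xs x).card ≤ N := by
  unfold labelQueries
  split_ifs
  · exact card_firstHits_le _ _ _
  · exact card_firstHits_le _ _ _
  · simp

theorem boxData_congr {M N : ℕ} {o : Offset d η} {xs : Fin M → Cube d} {J : Fin d → ℕ}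
    {ys ys' : Fin M → unitInterval} (h : ∀ i ∈ kept L η N o xs J, ys i = ys' i) :
    boxData L η N o xs ys J = boxData L η N o xs ys' J :=
  Multiset.map_congr rfl fun i hi => by rw [h i hi]

theorem query_congr {M N : ℕ} {o : Offset d η} {xs : Fin M → Cube d} {x : Cube d}
    (A : Choices d L η) {ys ys' : Fin M → unitInterval}
    (h : ∀ i ∈ labelQueries L η N o xs x, ys i = ys' i) :
    query A N o xs ys x = query A N o xs ys' x := by
  unfold labelQueries at h
  unfold query
  split_ifs at h ⊢
  · rw [boxData_congr h]
  · rw [boxData_congr h]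
  · rfl

variable {M N : ℕ} {o : Offset d η} {xs : Fin M → Cube d} {ys : Fin M → unitInterval}

theorem query_of_mem_longBox (hL : 0 < L) (hη : 0 < η) (A : Choices d L η) {J : Fin d → ℕ}
    {x : Cube d} (hx : x ∈ longBox L η o J) :
    query A N o xs ys x = A.erm (boxData L η N o xs ys J) x := by
  have h : ∃ J, x ∈ longBox L η o J := ⟨J, hx⟩
  have hJ : h.choose = J :=
    eq_of_mem_longBox_of_mem_extBox hL hη h.choose_spec (longBox_subset_extBox hL o J hx)
  unfold query
  rw [dif_pos h, hJ]

theorem isShellExtension_ext (A : Choices d L η) {J : Fin d → ℕ} (hJ : IsBoxIndex L η o J)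
    (T : Multiset (Cube d × unitInterval)) :
    IsShellExtension L η o J (A.erm T) (A.ext o J (A.erm T)) :=
  A.ext_spec o J _ hJ (A.erm_spec T).1

/-- The algorithm may have selected another box containing `x` in its extension; `x` is then in both
mid-shells and both extensions give `1`. -/
theorem query_of_mem_extBox (hL : 0 < L) (hη : 0 < η) (A : Choices d L η) {J : Fin d → ℕ}
    (hJ : IsBoxIndex L η o J) {x : Cube d} (hx : x ∈ extBox L η o J) :
    query A N o xs ys x = A.ext o J (A.erm (boxData L η N o xs ys J)) x := by
  by_cases h : ∃ J, x ∈ longBox L η o J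
  · obtain ⟨J', hJ'⟩ := h
    obtain rfl := eq_of_mem_longBox_of_mem_extBox hL hη hJ' hx
    rw [query_of_mem_longBox hL hη A hJ', (isShellExtension_ext A hJ _).1 x hJ']
  · have h' : ∃ J, IsBoxIndex L η o J ∧ x ∈ extBox L η o J := ⟨J, hJ, hx⟩
    unfold query
    rw [dif_neg h, dif_pos h']
    by_cases he : h'.choose = J
    · rw [he]
    · rw [(isShellExtension_ext A h'.choose_spec.1 _).2.1 x
        (mem_midShell_of_mem_extBox_of_ne hL hη he h'.choose_spec.2 hx),
        (isShellExtension_ext A hJ _).2.1 x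
        (mem_midShell_of_mem_extBox_of_ne hL hη (Ne.symm he) hx h'.choose_spec.2)]

theorem query_of_forall_notMem (hL : 0 < L) (A : Choices d L η) {x : Cube d}
    (hx : ∀ J, IsBoxIndex L η o J → x ∉ extBox L η o J) : query A N o xs ys x = 1 := by
  unfold query
  rw [dif_neg, dif_neg]
  · rintro ⟨J, hJ, hxJ⟩
    exact hx J hJ hxJ
  · rintro ⟨J, hxJ⟩
    exact hx J (isBoxIndex_of_mem_longBox hxJ) (longBox_subset_extBox hL o J hxJ)

theorem query_mem_Icc (hL : 0 < L) (hη : 0 < η) (A : Choices d L η) (x : Cube d) :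
    query A N o xs ys x ∈ Set.Icc (0 : ℝ) 1 := by
  by_cases h : ∃ J, IsBoxIndex L η o J ∧ x ∈ extBox L η o J
  · obtain ⟨J, hJ, hx⟩ := h
    rw [query_of_mem_extBox hL hη A hJ hx]
    exact (isShellExtension_ext A hJ _).2.2.1 x hx
  · push Not at h
    rw [query_of_forall_notMem hL A h]
    simp

theorem query_lipschitz_or (hL : 0 < L) (hη : 0 < η) (A : Choices d L η) (x y : Cube d) :
    |query A N o xs ys x - query A N o xs ys y| ≤ L * dist x y ∨
      1 - query A N o xs ys x ≤ L * dist x y := by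
  by_cases h : ∃ J, IsBoxIndex L η o J ∧ x ∈ extBox L η o J
  · obtain ⟨J, hJ, hx⟩ := h
    have hs := isShellExtension_ext A hJ (boxData L η N o xs ys J)
    rw [query_of_mem_extBox hL hη A hJ hx]
    by_cases hy : y ∈ extBox L η o J
    · left
      rw [query_of_mem_extBox hL hη A hJ hy]
      exact hs.2.2.2 x hx y hy
    · right
      obtain ⟨z, hz, hd⟩ := exists_mem_midShell_dist_le hL hx hy
      have h1 := hs.2.2.2 x hx z hz.1
      rw [hs.2.1 z hz] at h1
      have h2 : L * dist x z ≤ L * dist x y := by gcongr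
      linarith [neg_abs_le (A.ext o J (A.erm (boxData L η N o xs ys J)) x - 1)]
  · right
    push Not at h
    rw [query_of_forall_notMem hL A h, sub_self]
    positivity

theorem query_mem_lipClass (hL : 0 < L) (hη : 0 < η) (A : Choices d L η) (N : ℕ)
    (o : Offset d η) (xs : Fin M → Cube d) (ys : Fin M → unitInterval) :
    query A N o xs ys ∈ lipClass d L := by
  refine ⟨fun x => query_mem_Icc hL hη A x, fun x y => ?_⟩
  have hx := query_mem_Icc (N := N) (o := o) (xs := xs) (ys := ys) hL hη A x
  have hy := query_mem_Icc (N := N) (o := o) (xs := xs) (ys := ys) hL hη A y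
  rcases query_lipschitz_or (N := N) (o := o) (xs := xs) (ys := ys) hL hη A x y with h | h
  · exact h
  rcases query_lipschitz_or (N := N) (o := o) (xs := xs) (ys := ys) hL hη A y x with h' | h'
  · rwa [abs_sub_comm, dist_comm]
  -- Both answers now lie in `[1 - L * dist x y, 1]`.
  rw [dist_comm] at h'
  rw [abs_le]
  constructor <;> linarith [hx.2, hy.2]

end Algorithm

/-! ### Second moments of predictably weighted sums. -/

section Orthogonality

variable {Z : Type*} [MeasurableSpace Z] (D : Measure Z) [IsProbabilityMeasure D]

/-- Fubini after splitting off the coordinate `j`, on which `g` does not depend. The product formula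
for integrals holds without integrability assumptions. -/
theorem integral_mul_eval {M : ℕ} (j : Fin M) {g : (Fin M → Z) → ℝ} (φ : Z → ℝ)
    (hg : ∀ z w, g (Function.update z j w) = g z) :
    ∫ z, g z * φ (z j) ∂(Measure.pi fun _ : Fin M => D) =
      (∫ z, g z ∂(Measure.pi fun _ : Fin M => D)) * ∫ w, φ w ∂D := by
  obtain ⟨n, rfl⟩ : ∃ n, M = n + 1 := ⟨M - 1, by have := j.pos; omega⟩
  obtain ⟨a₀⟩ : Nonempty Z := nonempty_of_isProbabilityMeasure D
  have he := (measurePreserving_piFinSuccAbove (fun _ : Fin (n + 1) => D) j).symm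
  have hg' : ∀ (a : Z) (r : Fin n → Z), g (j.insertNth a r) = g (j.insertNth a₀ r) := by
    intro a r
    rw [← hg (j.insertNth a r) a₀, Fin.update_insertNth]
  rw [← he.integral_comp', ← he.integral_comp']
  simp only [MeasurableEquiv.piFinSuccAbove_symm_apply, Fin.insertNthEquiv, Equiv.coe_fn_mk]
  have h1 : ∀ p : Z × (Fin n → Z), g (j.insertNth p.1 p.2) *
      φ ((j.insertNth p.1 p.2 : Fin (n + 1) → Z) j) = φ p.1 * g (j.insertNth a₀ p.2) := by
    intro p
    rw [hg', Fin.insertNth_apply_same, mul_comm]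
  have h2 : ∀ p : Z × (Fin n → Z), g (j.insertNth p.1 p.2) =
      (fun _ => (1 : ℝ)) p.1 * g (j.insertNth a₀ p.2) := by
    intro p
    rw [hg', one_mul]
  simp_rw [h1]
  have i1 := integral_prod_mul (μ := D) (ν := Measure.pi fun _ : Fin n => D) φ
    fun r => g (j.insertNth a₀ r)
  have i2 := integral_prod_mul (μ := D) (ν := Measure.pi fun _ : Fin n => D) (fun _ => (1 : ℝ))
    fun r => g (j.insertNth a₀ r)
  rw [integral_congr_ae (Filter.Eventually.of_forall h2), i1, i2]
  simp [mul_comm]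

theorem integrable_of_abs_le {Ω : Type*} [MeasurableSpace Ω] {μ : Measure Ω} [IsFiniteMeasure μ]
    {f : Ω → ℝ} (hf : Measurable f) (C : ℝ) (hC : ∀ x, |f x| ≤ C) : Integrable f μ :=
  Integrable.of_bound hf.aestronglyMeasurable C (Filter.Eventually.of_forall hC)

/-- The summands are martingale differences: `haa` says that `a i` depends only on coordinates
before `i`. In a cross term with `i < j`, the coordinate `j` enters only through the centred factor
`φ (z j)`. -/
theorem integral_sq_sum_adapted {M : ℕ} {a : Fin M → (Fin M → Z) → ℝ} {φ : Z → ℝ}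
    (ham : ∀ i, Measurable (a i)) (ha1 : ∀ i z, |a i z| ≤ 1)
    (haa : ∀ i j, i ≤ j → ∀ z w, a i (Function.update z j w) = a i z)
    (hφm : Measurable φ) (hφ1 : ∀ w, |φ w| ≤ 1) (hφ0 : ∫ w, φ w ∂D = 0) :
    ∫ z, (∑ i, a i z * φ (z i)) ^ 2 ∂(Measure.pi fun _ : Fin M => D) =
      (∑ i, ∫ z, a i z ^ 2 ∂(Measure.pi fun _ : Fin M => D)) * ∫ w, φ w ^ 2 ∂D := by
  set P := Measure.pi fun _ : Fin M => D
  have hm : ∀ i, Measurable fun z : Fin M → Z => a i z * φ (z i) := fun i =>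
    (ham i).mul (hφm.comp (measurable_pi_apply i))
  have hb : ∀ i z, |a i z * φ (z i)| ≤ 1 := fun i z => by
    rw [abs_mul]
    exact mul_le_one₀ (ha1 i z) (abs_nonneg _) (hφ1 _)
  have hint : ∀ i j, Integrable (fun z => (a i z * φ (z i)) * (a j z * φ (z j))) P :=
    fun i j => integrable_of_abs_le ((hm i).mul (hm j)) 1 fun z => by
      rw [abs_mul]
      exact mul_le_one₀ (hb i z) (abs_nonneg _) (hb j z)
  have cross : ∀ i j, i < j → ∫ z, (a i z * φ (z i)) * (a j z * φ (z j)) ∂P = 0 := by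
    intro i j hij
    have : ∀ z : Fin M → Z, (a i z * φ (z i)) * (a j z * φ (z j)) =
        (a i z * φ (z i) * a j z) * φ (z j) := fun z => by ring
    simp_rw [this]
    rw [integral_mul_eval D j φ (g := fun z => a i z * φ (z i) * a j z), hφ0, mul_zero]
    intro z w
    simp only [haa i j hij.le, haa j j le_rfl, Function.update_of_ne hij.ne]
  have diag : ∀ i, ∫ z, (a i z * φ (z i)) * (a i z * φ (z i)) ∂P =
      (∫ z, a i z ^ 2 ∂P) * ∫ w, φ w ^ 2 ∂D := by
    intro i
    have : ∀ z : Fin M → Z, (a i z * φ (z i)) * (a i z * φ (z i)) =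
        a i z ^ 2 * (fun w => φ w ^ 2) (z i) := fun z => by ring
    simp_rw [this]
    exact integral_mul_eval D i (fun w => φ w ^ 2) (g := fun z => a i z ^ 2)
      fun z w => by rw [haa i i le_rfl]
  simp_rw [sq (∑ i, _), Finset.sum_mul_sum]
  rw [integral_finsetSum _ fun i _ => integrable_finsetSum _ fun j _ => hint i j,
    Finset.sum_mul]
  refine Finset.sum_congr rfl fun i _ => ?_
  rw [integral_finsetSum _ fun j _ => hint i j, Finset.sum_eq_single i, diag]
  · intro j _ hji
    rcases lt_or_gt_of_ne hji with h | h
    · rw [← cross j i h]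
      simp_rw [mul_comm]
    · exact cross i j h
  · simp

theorem integral_abs_le_sqrt {Ω : Type*} [MeasurableSpace Ω] {μ : Measure Ω}
    [IsProbabilityMeasure μ] {X : Ω → ℝ} (hX : Measurable X) (C : ℝ) (hC : ∀ x, |X x| ≤ C)
    {v : ℝ} (hv : ∫ x, X x ^ 2 ∂μ ≤ v) : ∫ x, |X x| ∂μ ≤ √v := by
  refine Real.le_sqrt_of_sq_le (le_trans ?_ hv)
  have h2 : Integrable (fun x => X x ^ 2) μ := integrable_of_abs_le (hX.pow_const 2) (C ^ 2)
    fun x => by rw [abs_pow]; exact pow_le_pow_left₀ (abs_nonneg _) (hC x) 2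
  have h1 : Integrable (fun x => |X x|) μ := integrable_of_abs_le hX.abs C
    fun x => by rw [abs_abs]; exact hC x
  set c := ∫ x, |X x| ∂μ
  -- Nonnegativity of the variance of `|X|` replaces Jensen's inequality.
  have h3 : 0 ≤ ∫ x, (|X x| - c) ^ 2 ∂μ := integral_nonneg fun x => sq_nonneg _
  have h4 : ∫ x, (|X x| - c) ^ 2 ∂μ = ∫ x, X x ^ 2 ∂μ - 2 * c * c + c ^ 2 := by
    have : ∀ x, (|X x| - c) ^ 2 = X x ^ 2 - 2 * c * |X x| + c ^ 2 := fun x => by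
      rw [sub_sq, sq_abs]; ring
    simp_rw [this]
    have h5 : Integrable (fun x => X x ^ 2 - 2 * c * |X x|) μ := h2.sub (h1.const_mul _)
    rw [integral_add h5 (integrable_const _), integral_sub h2 (h1.const_mul _),
      integral_const_mul]
    simp [c]
  nlinarith

end Orthogonality

/-! ### Deviations over the first `N` hits of a box. -/

section Truncated

variable {Z : Type*} {M : ℕ}

open Classical in
/-- Indicator that fewer than `N` entries before position `i` lie in `B`. -/
noncomputable def gate (B : Set Z) (N : ℕ) (i : Fin M) (z : Fin M → Z) : ℝ :=
  if (Finset.univ.filter fun i' => i' < i ∧ z i' ∈ B).card < N then 1 else 0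

open Classical in
/-- The number of entries of `z` in `B`. -/
noncomputable def hitCount (B : Set Z) (z : Fin M → Z) : ℕ :=
  (Finset.univ.filter fun i => z i ∈ B).card

theorem gate_sq (B : Set Z) (N : ℕ) (i : Fin M) (z : Fin M → Z) :
    gate B N i z ^ 2 = gate B N i z := by
  unfold gate
  split_ifs <;> simp

theorem gate_nonneg (B : Set Z) (N : ℕ) (i : Fin M) (z : Fin M → Z) : 0 ≤ gate B N i z := by
  unfold gate
  split_ifs <;> simp

theorem gate_le_one (B : Set Z) (N : ℕ) (i : Fin M) (z : Fin M → Z) : gate B N i z ≤ 1 := by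
  unfold gate
  split_ifs <;> simp

theorem abs_gate_le_one (B : Set Z) (N : ℕ) (i : Fin M) (z : Fin M → Z) :
    |gate B N i z| ≤ 1 := by
  rw [abs_of_nonneg (gate_nonneg B N i z)]
  exact gate_le_one B N i z

theorem gate_update (B : Set Z) (N : ℕ) {i j : Fin M} (hij : i ≤ j) (z : Fin M → Z) (w : Z) :
    gate B N i (Function.update z j w) = gate B N i z := by
  classical
  unfold gate
  congr 3
  ext i'
  simp only [Finset.mem_filter, Finset.mem_univ, true_and]
  refine and_congr_right fun h => ?_
  rw [Function.update_of_ne (h.trans_le hij).ne]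

theorem sum_firstHits (B : Set Z) (N : ℕ) (z : Fin M → Z) (h : Z → ℝ) :
    ∑ i ∈ firstHits B N z, h (z i) = ∑ i, gate B N i z * B.indicator h (z i) := by
  classical
  rw [firstHits, Finset.sum_filter]
  refine Finset.sum_congr rfl fun i _ => ?_
  unfold gate
  by_cases h1 : z i ∈ B
  · rw [Set.indicator_of_mem h1]
    simp [h1]
  · rw [Set.indicator_of_notMem h1]
    simp [h1]

theorem hitCount_eq_sum (B : Set Z) (z : Fin M → Z) :
    (hitCount B z : ℝ) = ∑ i, B.indicator (fun _ => (1 : ℝ)) (z i) := by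
  classical
  simp [hitCount, Set.indicator_apply, Finset.sum_boole]

variable [MeasurableSpace Z]

theorem measurable_gate {B : Set Z} (hB : MeasurableSet B) (N : ℕ) (i : Fin M) :
    Measurable (gate B N i) := by
  classical
  unfold gate
  refine Measurable.ite ?_ measurable_const measurable_const
  have : Measurable fun z : Fin M → Z =>
      (Finset.univ.filter fun i' => i' < i ∧ z i' ∈ B).card := by
    simp_rw [Finset.card_filter]
    refine Finset.measurable_fun_sum _ fun i' _ =>
      Measurable.ite ?_ measurable_const measurable_const
    by_cases h : i' < i
    · simp only [h, true_and]
      exact measurable_pi_apply i' hB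
    · simp [h]
  exact measurableSet_lt this measurable_const

variable (D : Measure Z)

/-- The deviation of the sum of `h` over the first `N` hits of `B` from its conditional mean. -/
noncomputable def deviation (B : Set Z) (N : ℕ) (h : Z → ℝ) (z : Fin M → Z) : ℝ :=
  ∑ i ∈ firstHits B N z, h (z i) - (firstHits B N z).card * ((∫ w in B, h w ∂D) / D.real B)

/-- In this form the weights are predictable and the other factor is centred, so the orthogonality
applies although the number of summands is random. -/
theorem deviation_eq_sum (B : Set Z) (N : ℕ) (h : Z → ℝ) (z : Fin M → Z) :
    deviation D B N h z = ∑ i, gate B N i z *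
      B.indicator (fun w => h w - (∫ w in B, h w ∂D) / D.real B) (z i) := by
  rw [← sum_firstHits, Finset.sum_sub_distrib, Finset.sum_const, nsmul_eq_mul]
  rfl

theorem measurable_deviation {B : Set Z} (hB : MeasurableSet B) (N : ℕ) {h : Z → ℝ}
    (hh : Measurable h) : Measurable (deviation (M := M) D B N h) := by
  have : deviation (M := M) D B N h = fun z => ∑ i, gate B N i z *
      B.indicator (fun w => h w - (∫ w in B, h w ∂D) / D.real B) (z i) :=
    funext fun z => deviation_eq_sum D B N h z
  rw [this]
  exact Finset.measurable_fun_sum _ fun i _ => (measurable_gate hB N i).mul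
    (((hh.sub_const _).indicator hB).comp (measurable_pi_apply i))

theorem deviation_sum {B : Set Z} (N : ℕ) {A : Type*} (s : Finset A) (c : A → ℝ)
    (h : A → Z → ℝ) (hh : ∀ a ∈ s, Integrable (h a) D) (z : Fin M → Z) :
    deviation D B N (fun w => ∑ a ∈ s, c a * h a w) z = ∑ a ∈ s, c a * deviation D B N (h a) z := by
  unfold deviation
  rw [integral_finsetSum _ fun a ha => ((hh a ha).const_mul _).restrict, Finset.sum_comm]
  simp_rw [integral_const_mul, ← Finset.mul_sum, mul_sub, Finset.sum_sub_distrib, Finset.sum_div,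
    Finset.mul_sum]
  congr 1
  exact Finset.sum_congr rfl fun a _ => by ring

variable [IsProbabilityMeasure D]

/-- The left side is the expected number of kept hits: at most `N` by truncation, and at most `M`
times the mass because each gate is at most `1`. -/
theorem sum_integral_gate_mul_le {B : Set Z} (hB : MeasurableSet B) (N : ℕ) :
    (∑ i : Fin M, ∫ z, gate B N i z ^ 2 ∂(Measure.pi fun _ : Fin M => D)) * D.real B ≤
      min (N : ℝ) (M * D.real B) := by
  classical
  have hint : ∀ i, Integrable (gate B N i) (Measure.pi fun _ : Fin M => D) := fun i =>
    integrable_of_abs_le (measurable_gate hB N i) 1 (abs_gate_le_one B N i)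
  simp_rw [gate_sq]
  refine le_min ?_ ?_
  · have hb : ∫ w, B.indicator (fun _ => (1 : ℝ)) w ∂D = D.real B := by
      rw [integral_indicator hB]
      simp
    rw [Finset.sum_mul, ← hb]
    have h1 : ∀ i, Integrable (fun z : Fin M → Z => gate B N i z *
        B.indicator (fun _ => (1 : ℝ)) (z i)) (Measure.pi fun _ : Fin M => D) := fun i =>
      integrable_of_abs_le ((measurable_gate hB N i).mul
        ((measurable_const.indicator hB).comp (measurable_pi_apply i))) 1 fun z => by
          rw [abs_mul]
          refine mul_le_one₀ (abs_gate_le_one _ _ _ _) (abs_nonneg _) ?_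
          rw [Set.indicator_apply]
          split_ifs <;> simp
    simp_rw [← fun i => integral_mul_eval D i (B.indicator fun _ => (1 : ℝ))
      (gate_update B N (le_refl i))]
    rw [← integral_finsetSum _ fun i _ => h1 i]
    have h2 : ∀ z : Fin M → Z, ∑ i, gate B N i z * B.indicator (fun _ => (1 : ℝ)) (z i) ≤ N := by
      intro z
      rw [← sum_firstHits, Finset.sum_const, nsmul_eq_mul, mul_one]
      exact_mod_cast card_firstHits_le B N z
    refine (integral_mono (integrable_finsetSum _ fun i _ => h1 i) (integrable_const (N : ℝ))
      h2).trans ?_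
    simp
  · refine mul_le_mul_of_nonneg_right ?_ measureReal_nonneg
    refine (Finset.sum_le_card_nsmul _ _ 1 fun i _ => ?_).trans ?_
    · refine (integral_mono (hint i) (integrable_const 1) (gate_le_one B N i)).trans ?_
      simp
    · simp

theorem abs_sum_le_of_abs_le_one {a : Fin M → ℝ} (ha : ∀ i, |a i| ≤ 1) : |∑ i, a i| ≤ M := by
  refine (Finset.abs_sum_le_sum_abs _ _).trans
    ((Finset.sum_le_card_nsmul _ _ 1 fun i _ => ha i).trans ?_)
  simp

theorem setIntegral_div_mem_Icc {B : Set Z} (hp : 0 < D.real B)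
    {h : Z → ℝ} (hh : Measurable h) (h01 : ∀ w, h w ∈ Set.Icc (0 : ℝ) 1) :
    (∫ w in B, h w ∂D) / D.real B ∈ Set.Icc (0 : ℝ) 1 := by
  have hint : Integrable h D := integrable_of_abs_le hh 1 fun w => by
    rw [abs_of_nonneg (h01 w).1]; exact (h01 w).2
  refine ⟨div_nonneg (integral_nonneg fun w => (h01 w).1) hp.le, (div_le_one hp).2 ?_⟩
  refine (integral_mono hint.restrict (integrable_const 1) fun w => (h01 w).2).trans ?_
  simp

theorem abs_centered_le_one {B : Set Z} (hp : 0 < D.real B)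
    {h : Z → ℝ} (hh : Measurable h) (h01 : ∀ w, h w ∈ Set.Icc (0 : ℝ) 1) (w : Z) :
    |B.indicator (fun w => h w - (∫ w in B, h w ∂D) / D.real B) w| ≤ 1 := by
  classical
  have h1 := setIntegral_div_mem_Icc D hp hh h01
  have h2 := h01 w
  rw [Set.indicator_apply]
  split_ifs
  · rw [abs_le]
    constructor <;> linarith [h1.1, h1.2, h2.1, h2.2]
  · simp

theorem abs_deviation_le {B : Set Z} (hp : 0 < D.real B) (N : ℕ)
    {h : Z → ℝ} (hh : Measurable h) (h01 : ∀ w, h w ∈ Set.Icc (0 : ℝ) 1) (z : Fin M → Z) :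
    |deviation D B N h z| ≤ M := by
  rw [deviation_eq_sum]
  refine abs_sum_le_of_abs_le_one fun i => ?_
  rw [abs_mul]
  exact mul_le_one₀ (abs_gate_le_one _ _ _ _) (abs_nonneg _)
    (abs_centered_le_one D hp hh h01 _)

/-- The variance of the centred function is at most its first moment since `h ^ 2 ≤ h`. Retaining
the conditional mean of `h`, instead of `1`, is what allows Cauchy-Schwarz over the cells later. -/
theorem integral_abs_deviation_le {B : Set Z} (hB : MeasurableSet B) (hp : 0 < D.real B) (N : ℕ)
    {h : Z → ℝ} (hh : Measurable h) (h01 : ∀ w, h w ∈ Set.Icc (0 : ℝ) 1) :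
    ∫ z, |deviation D B N h z| ∂(Measure.pi fun _ : Fin M => D) ≤
      √((∫ w in B, h w ∂D) / D.real B * min (N : ℝ) (M * D.real B)) := by
  classical
  refine integral_abs_le_sqrt (measurable_deviation D hB N hh) M
    (abs_deviation_le D hp N hh h01) ?_
  have hint : Integrable h D := integrable_of_abs_le hh 1 fun w => by
    rw [abs_of_nonneg (h01 w).1]; exact (h01 w).2
  have hint2 : Integrable (fun w => h w ^ 2) D := integrable_of_abs_le (hh.pow_const 2) 1
    fun w => by
      rw [abs_of_nonneg (sq_nonneg _)]
      exact pow_le_one₀ (h01 w).1 (h01 w).2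
  set q := (∫ w in B, h w ∂D) / D.real B with hq
  have hqp : q * D.real B = ∫ w in B, h w ∂D := div_mul_cancel₀ _ hp.ne'
  have hq0 : 0 ≤ q := (setIntegral_div_mem_Icc D hp hh h01).1
  set φ : Z → ℝ := B.indicator fun w => h w - q with hφ
  have hφm : Measurable φ := (hh.sub_const _).indicator hB
  have hφ0 : ∫ w, φ w ∂D = 0 := by
    rw [hφ, integral_indicator hB, integral_sub hint.restrict (integrable_const _), ← hqp]
    simp [mul_comm]
  have hφ2 : ∫ w, φ w ^ 2 ∂D ≤ q * D.real B := by
    have e1 : (fun w => φ w ^ 2) = B.indicator fun w => h w ^ 2 - 2 * q * h w + q ^ 2 := by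
      ext w
      simp only [hφ, Set.indicator_apply]
      split_ifs
      · ring
      · simp
    have i1 : Integrable (fun w => h w ^ 2 - 2 * q * h w) (D.restrict B) :=
      (hint2.sub (hint.const_mul _)).restrict
    have e2 : ∫ w, φ w ^ 2 ∂D = ∫ w in B, h w ^ 2 ∂D - 2 * q * (q * D.real B) +
        q ^ 2 * D.real B := by
      rw [e1, integral_indicator hB, integral_add i1 (integrable_const _),
        integral_sub hint2.restrict (hint.restrict.const_mul _), integral_const_mul, hqp]
      simp [mul_comm]
    have e3 : ∫ w in B, h w ^ 2 ∂D ≤ q * D.real B := by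
      rw [hqp]
      exact integral_mono hint2.restrict hint.restrict fun w =>
        pow_le_of_le_one (h01 w).1 (h01 w).2 two_ne_zero
    have e4 : 0 ≤ q ^ 2 * D.real B := by positivity
    rw [e2]
    linarith
  simp_rw [deviation_eq_sum]
  rw [integral_sq_sum_adapted D (fun i => measurable_gate hB N i) (abs_gate_le_one B N)
    (fun i j hij z w => gate_update B N hij z w) hφm
    (abs_centered_le_one D hp hh h01) hφ0]
  have hg := sum_integral_gate_mul_le (M := M) D hB N
  have hg0 : 0 ≤ ∑ i : Fin M, ∫ z, gate B N i z ^ 2 ∂(Measure.pi fun _ : Fin M => D) :=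
    Finset.sum_nonneg fun i _ => integral_nonneg fun z => sq_nonneg _
  calc _ ≤ (∑ i : Fin M, ∫ z, gate B N i z ^ 2 ∂(Measure.pi fun _ : Fin M => D)) *
        (q * D.real B) := mul_le_mul_of_nonneg_left hφ2 hg0
    _ = q * ((∑ i : Fin M, ∫ z, gate B N i z ^ 2 ∂(Measure.pi fun _ : Fin M => D)) *
        D.real B) := by ring
    _ ≤ _ := mul_le_mul_of_nonneg_left hg hq0

theorem measurable_hitCount {B : Set Z} (hB : MeasurableSet B) :
    Measurable fun z : Fin M → Z => (hitCount B z : ℝ) := by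
  simp_rw [hitCount_eq_sum]
  exact Finset.measurable_fun_sum _ fun i _ =>
    (measurable_const.indicator hB).comp (measurable_pi_apply i)

theorem abs_hitCount_sub_le (B : Set Z) (z : Fin M → Z) :
    |(hitCount B z : ℝ) - M * D.real B| ≤ M := by
  classical
  have h1 : hitCount B z ≤ M := by
    rw [hitCount]
    exact (Finset.card_filter_le _ _).trans (by simp)
  have h2 : (hitCount B z : ℝ) ≤ M := by exact_mod_cast h1
  have h3 : (M : ℝ) * D.real B ≤ M := mul_le_of_le_one_right (Nat.cast_nonneg _) measureReal_le_one
  have h4 : 0 ≤ (M : ℝ) * D.real B := by positivity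
  rw [abs_le]
  constructor <;> linarith [(Nat.cast_nonneg (hitCount B z) : (0 : ℝ) ≤ _)]

theorem integral_abs_hitCount_sub_le {B : Set Z} (hB : MeasurableSet B) :
    ∫ z, |(hitCount B z : ℝ) - M * D.real B| ∂(Measure.pi fun _ : Fin M => D) ≤
      √(M * D.real B) := by
  classical
  refine integral_abs_le_sqrt ((measurable_hitCount hB).sub_const _) M
    (abs_hitCount_sub_le D B) ?_
  have hp1 : D.real B ≤ 1 := measureReal_le_one
  have hp0 : 0 ≤ D.real B := measureReal_nonneg
  set p := D.real B
  set φ : Z → ℝ := fun w => B.indicator (fun _ => (1 : ℝ)) w - p with hφ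
  have hm : Measurable (B.indicator fun _ => (1 : ℝ)) := measurable_const.indicator hB
  have hi : Integrable (B.indicator fun _ => (1 : ℝ)) D := integrable_of_abs_le hm 1 fun w => by
    rw [Set.indicator_apply]
    split_ifs <;> simp
  have hb : ∫ w, B.indicator (fun _ => (1 : ℝ)) w ∂D = p := by
    rw [integral_indicator hB]
    simp [p]
  have h1 : ∀ w, |φ w| ≤ 1 := fun w => by
    simp only [hφ, Set.indicator_apply]
    split_ifs <;> rw [abs_le] <;> constructor <;> linarith
  have h0 : ∫ w, φ w ∂D = 0 := by
    rw [hφ, integral_sub hi (integrable_const _), hb]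
    simp
  have h2 : ∫ w, φ w ^ 2 ∂D ≤ p := by
    have e : ∀ w, φ w ^ 2 = (1 - 2 * p) * B.indicator (fun _ => (1 : ℝ)) w + p ^ 2 := fun w => by
      simp only [hφ, Set.indicator_apply]
      split_ifs <;> ring
    simp_rw [e]
    rw [integral_add (hi.const_mul _) (integrable_const _), integral_const_mul, hb]
    simp
    nlinarith
  have e : ∀ z : Fin M → Z, (hitCount B z : ℝ) - M * p =
      ∑ i, (fun _ _ => 1 : Fin M → (Fin M → Z) → ℝ) i z * φ (z i) := fun z => by
    rw [hitCount_eq_sum]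
    simp [hφ, Finset.sum_sub_distrib]
  simp_rw [e]
  rw [integral_sq_sum_adapted D (fun i => measurable_const) (fun i z => by simp)
    (fun i j _ z w => rfl) (hm.sub_const p) h1 h0]
  simpa using mul_le_mul_of_nonneg_left h2 (Nat.cast_nonneg M)

theorem abs_deviation_sub_le {B : Set Z} (hp : 0 < D.real B) (N : ℕ)
    {h h' : Z → ℝ} (hh : Integrable h D) (hh' : Integrable h' D) {α : ℝ}
    (hα : ∀ w ∈ B, |h w - h' w| ≤ α) (z : Fin M → Z) :
    |deviation D B N h z - deviation D B N h' z| ≤ 2 * α * (firstHits B N z).card := by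
  have hmem : ∀ i ∈ firstHits B N z, z i ∈ B := fun i hi => by
    classical
    exact (Finset.mem_filter.1 hi).2.1
  have e : deviation D B N h z - deviation D B N h' z =
      ∑ i ∈ firstHits B N z, (h (z i) - h' (z i)) - (firstHits B N z).card *
        ((∫ w in B, (h w - h' w) ∂D) / D.real B) := by
    unfold deviation
    rw [integral_sub hh.restrict hh'.restrict, Finset.sum_sub_distrib]
    ring
  have h1 : |∑ i ∈ firstHits B N z, (h (z i) - h' (z i))| ≤ (firstHits B N z).card * α := by
    refine (Finset.abs_sum_le_sum_abs _ _).trans ?_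
    rw [← nsmul_eq_mul]
    exact Finset.sum_le_card_nsmul _ _ _ fun i hi => hα _ (hmem i hi)
  have h2 : |(∫ w in B, (h w - h' w) ∂D) / D.real B| ≤ α := by
    rw [abs_div, abs_of_pos hp, div_le_iff₀ hp]
    exact norm_setIntegral_le_of_norm_le_const (f := fun w => h w - h' w) (measure_lt_top D B) hα
  have h3 : |((firstHits B N z).card : ℝ) * ((∫ w in B, (h w - h' w) ∂D) / D.real B)| ≤
      (firstHits B N z).card * α := by
    rw [abs_mul, abs_of_nonneg (Nat.cast_nonneg _)]
    gcongr
  rw [e]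
  refine (abs_sub _ _).trans ?_
  linarith

/-- A minimizer of the sum over the first hits nearly minimizes the integral over `B`, provided
that the deviations are small. -/
theorem setIntegral_sub_le {B : Set Z} (hM : 0 < M) {N : ℕ} (hN : 0 < N)
    {f g : Z → ℝ} (hf : Measurable f) (hg : Measurable g) (hf01 : ∀ w, f w ∈ Set.Icc (0 : ℝ) 1)
    (hg01 : ∀ w, g w ∈ Set.Icc (0 : ℝ) 1) (z : Fin M → Z)
    (hfg : ∑ i ∈ firstHits B N z, f (z i) ≤ ∑ i ∈ firstHits B N z, g (z i)) {W α : ℝ}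
    (hW : 0 ≤ W) (hα : 0 ≤ α) (hp : 0 < D.real B)
    (hdf : |deviation D B N f z| ≤ W + 2 * α * (firstHits B N z).card)
    (hdg : |deviation D B N g z| ≤ W + 2 * α * (firstHits B N z).card) :
    ∫ w in B, f w ∂D - ∫ w in B, g w ∂D ≤ 4 * α * D.real B +
      2 * D.real B * W / min (N : ℝ) (M * D.real B) + |(hitCount B z : ℝ) - M * D.real B| / M := by
  have hrf := setIntegral_div_mem_Icc D hp hf hf01
  have hrg := setIntegral_div_mem_Icc D hp hg hg01
  have hcard : ((firstHits B N z).card : ℝ) = min (N : ℝ) (hitCount B z) := by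
    rw [card_firstHits]
    push_cast
    rfl
  unfold deviation at hdf hdg
  set p := D.real B
  set n : ℝ := ((firstHits B N z).card : ℝ)
  set F := ∫ w in B, f w ∂D
  set G := ∫ w in B, g w ∂D
  set b : ℝ := (hitCount B z : ℝ)
  have hM' : (0 : ℝ) < M := by exact_mod_cast hM
  have hN' : (0 : ℝ) < N := by exact_mod_cast hN
  set m : ℝ := min (N : ℝ) (M * p) with hm
  have hm0 : 0 < m := lt_min hN' (by positivity)
  have hn0 : 0 ≤ n := Nat.cast_nonneg _
  have hb0 : 0 ≤ b := Nat.cast_nonneg _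
  have h1 : n * (F / p - G / p - 4 * α) ≤ 2 * W := by
    have := abs_le.1 hdf
    have := abs_le.1 hdg
    nlinarith
  set e := F / p - G / p - 4 * α with he
  -- As the normalized excess `e` is at most `1`, a shortage of hits, `n` instead of `m`, costs at
  -- most the missing fraction `1 - n / m`.
  have he1 : e ≤ 1 := by linarith [hrf.2, hrg.1]
  have h2 : e ≤ 2 * W / m + |b - M * p| / (M * p) := by
    have hMp : 0 < M * p := by positivity
    rcases le_or_gt e 0 with h | h
    · exact h.trans (by positivity)
    · have h3 : 1 - n / m ≤ |b - M * p| / (M * p) := by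
        rw [hcard]
        rcases le_total (N : ℝ) b with hNb | hNb
        · rw [min_eq_left hNb]
          have : 1 ≤ N / m := (one_le_div hm0).2 (min_le_left _ _)
          have : 0 ≤ |b - M * p| / (M * p) := by positivity
          linarith
        · rw [min_eq_right hNb]
          have h4 : b / (M * p) ≤ b / m := by
            gcongr
            exact min_le_right _ _
          have h5 : 1 - b / (M * p) ≤ |b - M * p| / (M * p) := by
            rw [one_sub_div hMp.ne']
            gcongr
            rw [abs_sub_comm]
            exact le_abs_self _
          linarith
      have h6 : e * (n / m) ≤ 2 * W / m := by
        rw [mul_div_assoc', mul_comm e]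
        gcongr
      have h7 : e * (1 - n / m) ≤ |b - M * p| / (M * p) := by
        rcases le_total 0 (1 - n / m) with h8 | h8
        · exact (mul_le_of_le_one_left h8 he1).trans h3
        · exact (mul_nonpos_of_nonneg_of_nonpos h.le h8).trans (by positivity)
      nlinarith
  have h9 : F - G = p * e + 4 * α * p := by
    rw [he]
    field_simp
    ring
  have h10 : p * e ≤ p * (2 * W / m + |b - M * p| / (M * p)) := by gcongr
  have h11 : p * (2 * W / m + |b - M * p| / (M * p)) = 2 * p * W / m + |b - M * p| / M := by
    field_simp
  linarith

end Truncated

/-! ### A deviation bound uniform over the Lipschitz class. -/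

section Cells

/-- The distance counts the levels `k` separating `a` and `b`. For fixed `b` each summand is affine
in the indicator of `k < a`; this linearizes the absolute loss in the label once the prediction is
fixed. -/
theorem sum_range_ite_lt {T a b : ℕ} (ha : a ≤ T) (hb : b ≤ T) :
    ∑ k ∈ Finset.range T, ((if k < b then (1 : ℝ) else 0) +
      (if k < b then (-1 : ℝ) else 1) * (if k < a then 1 else 0)) = |(a : ℝ) - b| := by
  have h1 : ∀ k, ((if k < b then (1 : ℝ) else 0) +
      (if k < b then (-1 : ℝ) else 1) * (if k < a then 1 else 0)) =
      if min a b ≤ k ∧ k < max a b then 1 else 0 := by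
    intro k
    by_cases h1 : k < a <;> by_cases h2 : k < b <;> simp [h1, h2]
  have h2 : (Finset.range T).filter (fun k => min a b ≤ k ∧ k < max a b) =
      Finset.Ico (min a b) (max a b) := by
    ext k
    simp only [Finset.mem_filter, Finset.mem_range, Finset.mem_Ico]
    omega
  simp_rw [h1]
  rw [Finset.sum_boole, h2, Nat.card_Ico]
  rcases le_total a b with h | h
  · rw [min_eq_left h, max_eq_right h, Nat.cast_sub h, abs_sub_comm, abs_of_nonneg]
    simpa using h
  · rw [min_eq_right h, max_eq_left h, Nat.cast_sub h, abs_of_nonneg]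
    simpa using h

theorem abs_sub_floor_div_le {T : ℕ} (hT : 0 < T) {u : ℝ} (hu : 0 ≤ u) :
    |u - ⌊T * u⌋₊ / T| ≤ 1 / T := by
  have hT' : (0 : ℝ) < T := by exact_mod_cast hT
  have h1 := Nat.floor_le (show 0 ≤ T * u by positivity)
  have h2 := Nat.lt_floor_add_one (T * u)
  have e : u - ⌊T * u⌋₊ / T = (T * u - ⌊T * u⌋₊) / T := by field_simp
  rw [e, abs_of_nonneg (div_nonneg (by linarith) hT'.le)]
  gcongr
  linarith

theorem floor_mul_le {T : ℕ} {u : ℝ} (hu : u ≤ 1) : ⌊(T : ℝ) * u⌋₊ ≤ T := by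
  refine Nat.floor_le_of_le ?_
  exact mul_le_of_le_one_right (Nat.cast_nonneg _) hu

theorem indicator_one_mem_Icc {Z : Type*} (A : Set Z) (w : Z) :
    A.indicator (fun _ => (1 : ℝ)) w ∈ Set.Icc (0 : ℝ) 1 := by
  classical
  rw [Set.indicator_apply]
  split_ifs <;> simp

variable {Z C : Type*} [MeasurableSpace Z] [Fintype C] {M : ℕ} (D : Measure Z)

/-- The mean over the levels `k < T` of the total deviation of the cells of `κ` and of their
sublevel parts `k < n`. -/
noncomputable def cellDeviation (B : Set Z) (N T : ℕ) (κ : Z → C) (n : Z → ℕ)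
    (z : Fin M → Z) : ℝ :=
  1 / T * ∑ k ∈ Finset.range T, ∑ c,
    (|deviation D B N ((κ ⁻¹' {c}).indicator fun _ => 1) z| +
      |deviation D B N (({w | k < n w} ∩ κ ⁻¹' {c}).indicator fun _ => 1) z|)

theorem cellDeviation_nonneg (B : Set Z) (N T : ℕ) (κ : Z → C) (n : Z → ℕ)
    (z : Fin M → Z) : 0 ≤ cellDeviation D B N T κ n z := by
  unfold cellDeviation
  positivity

theorem measurable_cellDeviation {B : Set Z} (hB : MeasurableSet B) (N T : ℕ) {κ : Z → C}
    {n : Z → ℕ} (hκ : ∀ c, MeasurableSet (κ ⁻¹' {c})) (hn : Measurable n) :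
    Measurable (cellDeviation (M := M) D B N T κ n) := by
  refine (Finset.measurable_fun_sum _ fun k _ =>
    Finset.measurable_fun_sum _ fun c _ => ?_).const_mul _
  exact (measurable_deviation D hB N (measurable_const.indicator (hκ c))).abs.add
    (measurable_deviation D hB N (measurable_const.indicator
      ((measurableSet_lt measurable_const hn).inter (hκ c)))).abs

variable [IsProbabilityMeasure D]

theorem integrable_indicator_one {A : Set Z} (hA : MeasurableSet A) :
    Integrable (A.indicator fun _ => (1 : ℝ)) D :=
  (integrable_const 1).indicator hA

theorem sum_setIntegral_indicator_cell {B : Set Z} {κ : Z → C}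
    (hκ : ∀ c, MeasurableSet (κ ⁻¹' {c})) :
    ∑ c, ∫ w in B, (κ ⁻¹' {c}).indicator (fun _ => (1 : ℝ)) w ∂D = D.real B := by
  classical
  rw [← integral_finsetSum _ fun c _ => (integrable_indicator_one D (hκ c)).restrict]
  have : ∀ w, ∑ c, (κ ⁻¹' {c}).indicator (fun _ => (1 : ℝ)) w = 1 := fun w => by
    simp [Set.indicator_apply]
  simp_rw [this]
  simp

theorem cellDeviation_le {B : Set Z} (hp : 0 < D.real B) (N : ℕ)
    {T : ℕ} {κ : Z → C} {n : Z → ℕ} (hκ : ∀ c, MeasurableSet (κ ⁻¹' {c}))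
    (hn : Measurable n) (z : Fin M → Z) :
    cellDeviation D B N T κ n z ≤ 1 / T * (T * (Fintype.card C * (M + M))) := by
  unfold cellDeviation
  refine mul_le_mul_of_nonneg_left ?_ (by positivity)
  have h1 : ∀ k c, |deviation D B N ((κ ⁻¹' {c}).indicator fun _ => 1) z| +
      |deviation D B N (({w | k < n w} ∩ κ ⁻¹' {c}).indicator fun _ => 1) z| ≤ (M + M : ℝ) :=
    fun k c => add_le_add
      (abs_deviation_le D hp N (measurable_const.indicator (hκ c)) (indicator_one_mem_Icc _) z)
      (abs_deviation_le D hp N (measurable_const.indicator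
        ((measurableSet_lt measurable_const hn).inter (hκ c))) (indicator_one_mem_Icc _) z)
  refine (Finset.sum_le_sum fun k _ => Finset.sum_le_sum fun c _ => h1 k c).trans (le_of_eq ?_)
  simp
  ring

/-- A cell of conditional mass `q c` contributes at most `√(q c * m)` per indicator, and its
sublevel parts no more. The `q c` sum to `1`, so Cauchy-Schwarz gives the square root of the number
of cells. -/
theorem integral_cellDeviation_le {B : Set Z} (hB : MeasurableSet B) (hp : 0 < D.real B) (N : ℕ)
    {T : ℕ} (hT : 0 < T) {κ : Z → C} {n : Z → ℕ} (hκ : ∀ c, MeasurableSet (κ ⁻¹' {c}))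
    (hn : Measurable n) :
    ∫ z, cellDeviation D B N T κ n z ∂(Measure.pi fun _ : Fin M => D) ≤
      2 * √(min (N : ℝ) (M * D.real B) * Fintype.card C) := by
  set P := Measure.pi fun _ : Fin M => D
  set m := min (N : ℝ) (M * D.real B) with hm
  have hm0 : 0 ≤ m := by positivity
  set q : C → ℝ := fun c => (∫ w in B, (κ ⁻¹' {c}).indicator (fun _ => (1 : ℝ)) w ∂D) / D.real B
    with hq
  have hmeas : ∀ k c, MeasurableSet ({w | k < n w} ∩ κ ⁻¹' {c}) := fun k c =>
    (measurableSet_lt measurable_const hn).inter (hκ c)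
  have hint : ∀ {A : Set Z}, MeasurableSet A →
      Integrable (fun z : Fin M → Z => |deviation D B N (A.indicator fun _ => 1) z|) P :=
    fun {A} hA => integrable_of_abs_le
      (measurable_deviation D hB N (measurable_const.indicator hA)).abs M fun z => by
        rw [abs_abs]
        exact abs_deviation_le D hp N (measurable_const.indicator hA) (indicator_one_mem_Icc _) z
  have h1 : ∀ c, ∫ z, |deviation D B N ((κ ⁻¹' {c}).indicator fun _ => 1) z| ∂P ≤
      √(q c * m) := fun c =>
    integral_abs_deviation_le D hB hp N (measurable_const.indicator (hκ c))
      (indicator_one_mem_Icc _)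
  have h2 : ∀ k c, ∫ z, |deviation D B N (({w | k < n w} ∩ κ ⁻¹' {c}).indicator fun _ => 1) z| ∂P ≤
      √(q c * m) := by
    intro k c
    refine (integral_abs_deviation_le D hB hp N (measurable_const.indicator (hmeas k c))
      (indicator_one_mem_Icc _)).trans (Real.sqrt_le_sqrt ?_)
    refine mul_le_mul_of_nonneg_right (div_le_div_of_nonneg_right ?_ hp.le) hm0
    refine integral_mono (integrable_indicator_one D (hmeas k c)).restrict
      (integrable_indicator_one D (hκ c)).restrict fun w => ?_
    exact Set.indicator_le_indicator_of_subset Set.inter_subset_right (fun _ => zero_le_one) w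
  have h3 : ∑ c, √(q c * m) ≤ √(m * Fintype.card C) := by
    have h4 : ∑ c, q c = 1 := by
      rw [hq, ← Finset.sum_div, sum_setIntegral_indicator_cell D hκ, div_self hp.ne']
    have h5 := Real.sum_sqrt_mul_sqrt_le (Finset.univ : Finset C) (f := fun c => q c * m)
      (g := fun _ => 1) (fun c => mul_nonneg
        (setIntegral_div_mem_Icc D hp (measurable_const.indicator (hκ c))
          (indicator_one_mem_Icc _)).1 hm0) fun _ => zero_le_one
    rw [← Finset.sum_mul (f := q), h4, ← Real.sqrt_mul (by positivity)] at h5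
    simpa using h5
  have hsum : ∀ k c, Integrable (fun z : Fin M → Z =>
      |deviation D B N ((κ ⁻¹' {c}).indicator fun _ => 1) z| +
      |deviation D B N (({w | k < n w} ∩ κ ⁻¹' {c}).indicator fun _ => 1) z|) P :=
    fun k c => (hint (hκ c)).add (hint (hmeas k c))
  unfold cellDeviation
  rw [integral_const_mul, integral_finsetSum _ fun k _ => integrable_finsetSum _ fun c _ =>
    hsum k c]
  have h6 : ∀ k ∈ Finset.range T, ∫ z, ∑ c,
      (|deviation D B N ((κ ⁻¹' {c}).indicator fun _ => 1) z| +
      |deviation D B N (({w | k < n w} ∩ κ ⁻¹' {c}).indicator fun _ => 1) z|) ∂P ≤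
      2 * √(m * Fintype.card C) := by
    intro k _
    rw [integral_finsetSum _ fun c _ => hsum k c]
    refine le_trans (Finset.sum_le_sum (g := fun c => √(q c * m) + √(q c * m)) fun c _ => ?_) ?_
    · rw [integral_add (hint (hκ c)) (hint (hmeas k c))]
      exact add_le_add (h1 c) (h2 k c)
    · rw [Finset.sum_add_distrib]
      linarith
  have hT' : (0 : ℝ) < T := by exact_mod_cast hT
  calc _ ≤ 1 / (T : ℝ) * ∑ k ∈ Finset.range T, 2 * √(m * Fintype.card C) :=
        mul_le_mul_of_nonneg_left (Finset.sum_le_sum h6) (by positivity)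
    _ = _ := by
        rw [Finset.sum_const, Finset.card_range, nsmul_eq_mul]
        field_simp

/-- The function `f` enters the discretized loss only through coefficients of absolute value at most
`1`, so the first term on the right is the same for all `f`. -/
theorem abs_deviation_le_cellDeviation {B : Set Z} (hp : 0 < D.real B)
    (N : ℕ) {T : ℕ} (hT : 0 < T) {κ : Z → C} (hκ : ∀ c, MeasurableSet (κ ⁻¹' {c}))
    {y f : Z → ℝ} (hy : Measurable y) (hf : Measurable f) (hy01 : ∀ w, y w ∈ Set.Icc (0 : ℝ) 1)
    (hf01 : ∀ w, f w ∈ Set.Icc (0 : ℝ) 1) {β : ℝ}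
    (hβ : ∀ w ∈ B, ∀ w' ∈ B, κ w = κ w' → |f w - f w'| ≤ β) (z : Fin M → Z) :
    |deviation D B N (fun w => |y w - f w|) z| ≤
      cellDeviation D B N T κ (fun w => ⌊T * y w⌋₊) z +
        2 * (β + 2 / T) * (firstHits B N z).card := by
  classical
  have hT' : (0 : ℝ) < T := by exact_mod_cast hT
  set n : Z → ℕ := fun w => ⌊T * y w⌋₊ with hn
  have hnm : Measurable n := Nat.measurable_floor.comp (hy.const_mul _)
  have hmeas : ∀ k c, MeasurableSet ({w | k < n w} ∩ κ ⁻¹' {c}) := fun k c =>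
    (measurableSet_lt measurable_const hnm).inter (hκ c)
  -- The level of `f` at an arbitrary point of the cell inside `B`; cells missing `B` get `0`.
  have hrep : ∀ c, ∃ v : ℕ, v ≤ T ∧ ∀ w ∈ B, κ w = c → |f w - v / T| ≤ β + 1 / T := by
    intro c
    by_cases hc : ∃ w' ∈ B, κ w' = c
    · obtain ⟨w', hw'B, hw'⟩ := hc
      refine ⟨⌊T * f w'⌋₊, floor_mul_le (hf01 w').2, fun w hw hwc => ?_⟩
      have h1 := hβ w hw w' hw'B (hwc.trans hw'.symm)
      have h2 := abs_sub_floor_div_le hT (hf01 w').1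
      exact (abs_sub_le _ _ _).trans (add_le_add h1 h2)
    · exact ⟨0, Nat.zero_le _, fun w hw hwc => absurd ⟨w, hw, hwc⟩ hc⟩
  choose v hvT hv using hrep
  set s : ℕ → C → ℝ := fun k c => if k < v c then 1 else 0
  set t : ℕ → C → ℝ := fun k c => if k < v c then -1 else 1
  -- The discretized loss. The Boolean index separates the indicator of the cell from that of its
  -- part above level `k`, so that `deviation_sum` applies twice.
  set h' : Z → ℝ := fun w => ∑ p ∈ Finset.range T ×ˢ (Finset.univ : Finset C), 1 / T *
    (∑ b : Bool, (if b then s p.1 p.2 else t p.1 p.2) *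
      (if b then (κ ⁻¹' {p.2}).indicator (fun _ => (1 : ℝ)) w
        else ({w | p.1 < n w} ∩ κ ⁻¹' {p.2}).indicator (fun _ => (1 : ℝ)) w)) with hh'
  have hval : ∀ w, h' w = |(n w : ℝ) - v (κ w)| / T := by
    intro w
    rw [← sum_range_ite_lt (floor_mul_le (hy01 w).2) (hvT (κ w))]
    simp only [hh']
    rw [Finset.sum_product, Finset.sum_div]
    refine Finset.sum_congr rfl fun k _ => ?_
    rw [Finset.sum_eq_single (κ w)]
    · simp [s, t, Set.indicator_apply, hn, div_eq_inv_mul]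
    · intro c _ hc
      simp [Ne.symm hc]
    · simp
  have hint : ∀ p ∈ Finset.range T ×ˢ (Finset.univ : Finset C), ∀ b ∈ (Finset.univ : Finset Bool),
      Integrable (fun w => if b then (κ ⁻¹' {p.2}).indicator (fun _ => (1 : ℝ)) w
        else ({w | p.1 < n w} ∩ κ ⁻¹' {p.2}).indicator (fun _ => (1 : ℝ)) w) D := by
    intro p _ b _
    cases b
    · simpa using integrable_indicator_one D (hmeas p.1 p.2)
    · simpa using integrable_indicator_one D (hκ p.2)
  have hint' : ∀ p ∈ Finset.range T ×ˢ (Finset.univ : Finset C), Integrable (fun w =>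
      ∑ b : Bool, (if b then s p.1 p.2 else t p.1 p.2) *
      (if b then (κ ⁻¹' {p.2}).indicator (fun _ => (1 : ℝ)) w
        else ({w | p.1 < n w} ∩ κ ⁻¹' {p.2}).indicator (fun _ => (1 : ℝ)) w)) D :=
    fun p hp => integrable_finsetSum _ fun b hb => (hint p hp b hb).const_mul _
  have hdev : |deviation D B N h' z| ≤ cellDeviation D B N T κ n z := by
    rw [hh', deviation_sum D N _ _ _ hint', ← Finset.mul_sum, cellDeviation, abs_mul,
      abs_of_nonneg (by positivity : (0 : ℝ) ≤ 1 / T), ← Finset.sum_product']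
    refine mul_le_mul_of_nonneg_left ((Finset.abs_sum_le_sum_abs _ _).trans
      (Finset.sum_le_sum fun p hp => ?_)) (by positivity)
    rw [deviation_sum D N _ _ _ (hint p hp), Fintype.sum_bool]
    have hs : |s p.1 p.2| ≤ 1 := by
      simp only [s]; split_ifs <;> simp
    have ht : |t p.1 p.2| ≤ 1 := by
      simp only [t]; split_ifs <;> simp
    refine (abs_add_le _ _).trans (add_le_add ?_ ?_)
    · simp only [if_true]
      rw [abs_mul]
      exact mul_le_of_le_one_left (abs_nonneg _) hs
    · simp only [Bool.false_eq_true, if_false]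
      rw [abs_mul]
      exact mul_le_of_le_one_left (abs_nonneg _) ht
  have hyf : ∀ w, |(|y w - f w|)| ≤ 1 := fun w => by
    rw [abs_abs, abs_le]
    constructor <;> linarith [(hy01 w).1, (hy01 w).2, (hf01 w).1, (hf01 w).2]
  have hi1 : Integrable (fun w => |y w - f w|) D := integrable_of_abs_le (hy.sub hf).abs 1 hyf
  have hi2 : Integrable h' D := integrable_finsetSum _ fun p hp => (hint' p hp).const_mul _
  -- Rounding the label and rounding the prediction cost `1 / T` each; the oscillation of `f` on a
  -- cell costs `β`.
  have hclose : ∀ w ∈ B, |(|y w - f w|) - h' w| ≤ β + 2 / T := by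
    intro w hw
    have e : h' w = |(n w / T : ℝ) - v (κ w) / T| := by
      rw [hval, ← sub_div, abs_div, abs_of_pos hT']
    rw [e]
    refine (abs_abs_sub_abs_le_abs_sub _ _).trans ?_
    have h1 := abs_sub_floor_div_le hT (hy01 w).1
    have h2 := hv (κ w) w hw rfl
    have e2 : y w - f w - (n w / T - v (κ w) / T) =
        (y w - n w / T) - (f w - v (κ w) / T) := by ring
    rw [e2]
    refine (abs_sub _ _).trans ((add_le_add h1 h2).trans (le_of_eq ?_))
    ring
  have h3 := abs_deviation_sub_le D hp N hi1 hi2 hclose z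
  have h4 := abs_sub_abs_le_abs_sub (deviation D B N (fun w => |y w - f w|) z)
    (deviation D B N h' z)
  linarith

end Cells

/-! ### Expected excess, per box and summed over boxes. -/

section ExcessBound

variable {Z C : Type*} [MeasurableSpace Z] [Fintype C] {M : ℕ} (D : Measure Z)

/-- A bound on the excess error in `B` of a minimizer over the first `N` hits of `B`. -/
noncomputable def excessBound (B : Set Z) (N T : ℕ) (α : ℝ) (κ : Z → C) (n : Z → ℕ)
    (z : Fin M → Z) : ℝ :=
  4 * α * D.real B + 2 * D.real B * cellDeviation D B N T κ n z / min (N : ℝ) (M * D.real B) +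
    |(hitCount B z : ℝ) - M * D.real B| / M

theorem excessBound_nonneg (B : Set Z) (N T : ℕ) {α : ℝ} (hα : 0 ≤ α) (κ : Z → C) (n : Z → ℕ)
    (z : Fin M → Z) : 0 ≤ excessBound D B N T α κ n z := by
  have := cellDeviation_nonneg D B N T κ n z
  unfold excessBound
  positivity

theorem measurable_excessBound {B : Set Z} (hB : MeasurableSet B) (N T : ℕ) (α : ℝ) {κ : Z → C}
    {n : Z → ℕ} (hκ : ∀ c, MeasurableSet (κ ⁻¹' {c})) (hn : Measurable n) :
    Measurable (excessBound (M := M) D B N T α κ n) := by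
  unfold excessBound
  exact (((measurable_cellDeviation D hB N T hκ hn).const_mul _).div_const _).const_add _ |>.add
    ((((measurable_hitCount hB).sub_const _).abs).div_const _)

variable [IsProbabilityMeasure D]

theorem integrable_abs_hitCount_sub {B : Set Z} (hB : MeasurableSet B) :
    Integrable (fun z => |(hitCount B z : ℝ) - M * D.real B|) (Measure.pi fun _ : Fin M => D) :=
  integrable_of_abs_le ((measurable_hitCount hB).sub_const _).abs M fun z => by
    rw [abs_abs]
    exact abs_hitCount_sub_le D B z

theorem integrable_two_mul_cellDeviation {B : Set Z} (hB : MeasurableSet B) (N T : ℕ) {κ : Z → C}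
    {n : Z → ℕ} (hκ : ∀ c, MeasurableSet (κ ⁻¹' {c})) (hn : Measurable n) :
    Integrable (fun z => 2 * D.real B * cellDeviation D B N T κ n z / min (N : ℝ) (M * D.real B))
      (Measure.pi fun _ : Fin M => D) := by
  rcases (measureReal_nonneg (μ := D) (s := B)).eq_or_lt with hp | hp
  · simp [← hp]
  · refine Integrable.div_const (Integrable.const_mul ?_ _) _
    refine integrable_of_abs_le (measurable_cellDeviation D hB N T hκ hn)
      (1 / T * (T * (Fintype.card C * (M + M)))) fun z => ?_
    rw [abs_of_nonneg (cellDeviation_nonneg D B N T κ n z)]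
    exact cellDeviation_le D hp N hκ hn z

theorem integrable_excessBound {B : Set Z} (hB : MeasurableSet B) (N T : ℕ) (α : ℝ) {κ : Z → C}
    {n : Z → ℕ} (hκ : ∀ c, MeasurableSet (κ ⁻¹' {c})) (hn : Measurable n) :
    Integrable (excessBound (M := M) D B N T α κ n) (Measure.pi fun _ : Fin M => D) :=
  ((integrable_const _).add (integrable_two_mul_cellDeviation D hB N T hκ hn)).add
    ((integrable_abs_hitCount_sub D hB).div_const _)

theorem integral_excessBound_le {B : Set Z} (hB : MeasurableSet B) (hM : 0 < M) {N : ℕ}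
    (hN : 0 < N) {T : ℕ} (hT : 0 < T) (α : ℝ) {κ : Z → C} {n : Z → ℕ}
    (hκ : ∀ c, MeasurableSet (κ ⁻¹' {c})) (hn : Measurable n) :
    ∫ z, excessBound D B N T α κ n z ∂(Measure.pi fun _ : Fin M => D) ≤
      4 * α * D.real B + 4 * (D.real B * √(Fintype.card C / N)) +
        (4 * √(Fintype.card C / M) + √(1 / M)) * √(D.real B) := by
  unfold excessBound
  have hM' : (0 : ℝ) < M := by exact_mod_cast hM
  have hN' : (0 : ℝ) < N := by exact_mod_cast hN
  have i1 : Integrable (fun z : Fin M → Z => 4 * α * D.real B +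
      2 * D.real B * cellDeviation D B N T κ n z / min (N : ℝ) (M * D.real B))
      (Measure.pi fun _ : Fin M => D) :=
    (integrable_const _).add (integrable_two_mul_cellDeviation D hB N T hκ hn)
  rw [integral_add i1 ((integrable_abs_hitCount_sub D hB).div_const _),
    integral_add (integrable_const _) (integrable_two_mul_cellDeviation D hB N T hκ hn),
    integral_div, integral_div, integral_const_mul (2 * D.real B)]
  have h1 : (∫ z, |(hitCount B z : ℝ) - M * D.real B| ∂(Measure.pi fun _ : Fin M => D)) / M ≤
      √(1 / M) * √(D.real B) := by
    rw [div_le_iff₀ hM']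
    refine (integral_abs_hitCount_sub_le D hB).trans (le_of_eq ?_)
    rw [Real.sqrt_mul hM'.le, Real.sqrt_div zero_le_one, Real.sqrt_one]
    have h := Real.mul_self_sqrt hM'.le
    have h0 : √(M : ℝ) ≠ 0 := (Real.sqrt_pos.2 hM').ne'
    field_simp
    rw [sq, h]
    ring
  have h2 : 2 * D.real B * (∫ z, cellDeviation D B N T κ n z ∂(Measure.pi fun _ : Fin M => D)) /
      min (N : ℝ) (M * D.real B) ≤ 4 * (D.real B * √(Fintype.card C / N)) +
        4 * √(Fintype.card C / M) * √(D.real B) := by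
    rcases (measureReal_nonneg (μ := D) (s := B)).eq_or_lt with hp | hp
    · simp [← hp]
    · have h3 := integral_cellDeviation_le (M := M) D hB hp N hT hκ hn
      set p := D.real B
      set m := min (N : ℝ) (M * p) with hm
      have hm0 : 0 < m := lt_min hN' (by positivity)
      have hG : (0 : ℝ) ≤ Fintype.card C := Nat.cast_nonneg _
      have h4 : 2 * p * (2 * √(m * Fintype.card C)) / m = 4 * (p * √(Fintype.card C / m)) := by
        rw [Real.sqrt_mul hm0.le, Real.sqrt_div hG]
        have h := Real.mul_self_sqrt hm0.le
        have h0 : √m ≠ 0 := (Real.sqrt_pos.2 hm0).ne'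
        field_simp
        linear_combination 4 * √(Fintype.card C : ℝ) * h
      -- Both possible values of the minimum `m` are covered: `N` gives the first term, `M * p` the
      -- second.
      have h5 : p * √(Fintype.card C / m) ≤ p * √(Fintype.card C / N) +
          √(Fintype.card C / M) * √p := by
        rcases min_choice (N : ℝ) (M * p) with h | h
        · rw [hm, h]
          have : 0 ≤ √(Fintype.card C / M) * √p := by positivity
          linarith
        · rw [hm, h, ← div_div, Real.sqrt_div (by positivity)]
          have : 0 ≤ p * √(Fintype.card C / N) := by positivity
          have h6 : p * (√(Fintype.card C / M) / √p) = √(Fintype.card C / M) * √p := by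
            have h := Real.mul_self_sqrt hp.le
            have h0 : √p ≠ 0 := (Real.sqrt_pos.2 hp).ne'
            field_simp
            rw [sq, h]
            ring
          linarith
      calc _ ≤ 2 * p * (2 * √(m * Fintype.card C)) / m := by gcongr
        _ ≤ _ := by rw [h4]; linarith
  have h3 : ∫ _ : Fin M → Z, 4 * α * D.real B ∂(Measure.pi fun _ : Fin M => D) =
      4 * α * D.real B := by simp
  rw [h3]
  linarith

/-- Terms linear in the masses add up to at most one such term since the boxes are disjoint; for the
square roots, Cauchy-Schwarz gives `√(Fintype.card I)`. -/
theorem sum_integral_excessBound_le {I : Type*} [Fintype I] {B : I → Set Z}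
    (hB : ∀ J, MeasurableSet (B J)) (hd : Pairwise (Function.onFun Disjoint B)) (hM : 0 < M)
    {N : ℕ} (hN : 0 < N) {T : ℕ} (hT : 0 < T) {α : ℝ} (hα : 0 ≤ α) {κ : I → Z → C} {n : Z → ℕ}
    (hκ : ∀ J c, MeasurableSet (κ J ⁻¹' {c})) (hn : Measurable n) :
    ∑ J, ∫ z, excessBound D (B J) N T α (κ J) n z ∂(Measure.pi fun _ : Fin M => D) ≤
      4 * α + 4 * √(Fintype.card C / N) +
        (4 * √(Fintype.card C / M) + √(1 / M)) * √(Fintype.card I) := by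
  have h1 : ∑ J, D.real (B J) ≤ 1 := by
    rw [← measureReal_iUnion_fintype hd hB]
    exact measureReal_le_one
  have h2 : ∑ J, √(D.real (B J)) ≤ √(Fintype.card I) := by
    have h5 := Real.sum_sqrt_mul_sqrt_le (Finset.univ : Finset I) (f := fun J => D.real (B J))
      (g := fun _ => 1) (fun J => measureReal_nonneg) fun _ => zero_le_one
    simp only [Real.sqrt_one, mul_one, Finset.sum_const, Finset.card_univ, nsmul_eq_mul] at h5
    refine h5.trans (mul_le_of_le_one_left (Real.sqrt_nonneg _) ?_)
    exact Real.sqrt_le_one.2 h1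
  refine (Finset.sum_le_sum fun J _ =>
    integral_excessBound_le D (hB J) hM hN hT α (hκ J) hn).trans ?_
  rw [Finset.sum_add_distrib, Finset.sum_add_distrib, ← Finset.mul_sum, ← Finset.mul_sum,
    ← Finset.mul_sum, ← Finset.sum_mul]
  have h3 : 0 ≤ √((Fintype.card C : ℝ) / N) := Real.sqrt_nonneg _
  have h4 : 4 * α * ∑ J, D.real (B J) ≤ 4 * α := mul_le_of_le_one_right (by positivity) h1
  have h5 : (∑ J, D.real (B J)) * √((Fintype.card C : ℝ) / N) ≤ √((Fintype.card C : ℝ) / N) :=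
    mul_le_of_le_one_left h3 h1
  have h6 : (4 * √((Fintype.card C : ℝ) / M) + √(1 / M)) * ∑ J, √(D.real (B J)) ≤
      (4 * √((Fintype.card C : ℝ) / M) + √(1 / M)) * √(Fintype.card I) := by gcongr
  linarith

end ExcessBound

/-! ### Expected mass outside the long boxes. -/

section Offsets

variable {d : ℕ} {L η : ℝ}

/-- The points whose `j`-th coordinate lies in no long interval for the offset index `i`. -/
def shortSet (d : ℕ) (L η : ℝ) (j : Fin d) (i : ℕ) : Set (Cube d) :=
  {x | ∀ k, ¬ (breakpoint d L η i (2 * k) ≤ x j ∧ (x j : ℝ) ≤ breakpoint d L η i (2 * k + 1))}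

theorem measurableSet_longInterval (j : Fin d) (i k : ℕ) : MeasurableSet
    {x : Cube d | breakpoint d L η i (2 * k) ≤ x j ∧
      (x j : ℝ) ≤ breakpoint d L η i (2 * k + 1)} := by
  have h : Measurable fun x : Cube d => (x j : ℝ) :=
    measurable_subtype_coe.comp (measurable_pi_apply j)
  exact (measurableSet_le measurable_const h).inter (measurableSet_le h measurable_const)

theorem measurableSet_longBox (o : Offset d η) (J : Fin d → ℕ) :
    MeasurableSet (longBox L η o J) := by
  have : longBox L η o J = ⋂ j, {x : Cube d | breakpoint d L η (o j) (2 * J j) ≤ x j ∧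
      (x j : ℝ) ≤ breakpoint d L η (o j) (2 * J j + 1)} := by
    ext x
    simp [longBox]
  rw [this]
  exact MeasurableSet.iInter fun j => measurableSet_longInterval j _ _

theorem measurableSet_shortSet (j : Fin d) (i : ℕ) : MeasurableSet (shortSet d L η j i) := by
  have : shortSet d L η j i = ⋂ k, {x : Cube d | breakpoint d L η i (2 * k) ≤ x j ∧
      (x j : ℝ) ≤ breakpoint d L η i (2 * k + 1)}ᶜ := by
    ext x
    simp [shortSet]
  rw [this]
  exact MeasurableSet.iInter fun k => (measurableSet_longInterval j _ _).compl

theorem exists_mem_short_of_mem_shortSet (hL : 0 < L) (hη : 0 < η) {j : Fin d} {i : ℕ}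
    {x : Cube d} (hx : x ∈ shortSet d L η j i) :
    ∃ k : ℕ, i * (2 / L) + k * (2 / L + d / (L * η)) ≤ x j ∧
      (x j : ℝ) < i * (2 / L) + k * (2 / L + d / (L * η)) + 2 / L := by
  set P : ℝ := 2 / L + d / (L * η) with hP
  have hP0 : 0 < P := by positivity
  have h0 : (i : ℝ) * (2 / L) < x j := by
    have h1 : ¬ ((x j : ℝ) ≤ i * (2 / L)) := fun h1 =>
      hx 0 ⟨by simpa [breakpoint] using (x j).2.1, by simpa [breakpoint] using h1⟩
    exact not_le.1 h1
  set u := ((x j : ℝ) - i * (2 / L)) / P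
  have hu : 0 ≤ u := div_nonneg (by linarith) hP0.le
  -- `⌊u⌋₊` is the period containing the point; past the short part of that period, the point would
  -- be in the long interval of index `⌊u⌋₊ + 1`.
  have h1 : (⌊u⌋₊ : ℝ) * P ≤ (x j : ℝ) - i * (2 / L) := (le_div_iff₀ hP0).1 (Nat.floor_le hu)
  have h2 : (x j : ℝ) - i * (2 / L) < (⌊u⌋₊ + 1 : ℝ) * P :=
    (div_lt_iff₀ hP0).1 (Nat.lt_floor_add_one u)
  refine ⟨⌊u⌋₊, by linarith, ?_⟩
  by_contra h3
  refine hx (⌊u⌋₊ + 1) ⟨?_, ?_⟩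
  · rw [show 2 * (⌊u⌋₊ + 1) = 2 * ⌊u⌋₊ + 2 by ring, breakpoint_even]
    exact not_lt.1 h3
  · rw [breakpoint_odd]
    push_cast
    linarith

theorem cast_offset_le (hη : 0 < η) (i : Fin (offsetMax d η + 1)) :
    ((i : ℕ) : ℝ) ≤ d / (2 * η) := by
  have h1 : ((i : ℕ) : ℝ) ≤ offsetMax d η := by
    exact_mod_cast Nat.lt_succ_iff.1 i.2
  exact h1.trans (Nat.floor_le (by positivity))

theorem offset_mul_le (hL : 0 < L) (hη : 0 < η) (i : Fin (offsetMax d η + 1)) :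
    ((i : ℕ) : ℝ) * (2 / L) ≤ d / (L * η) := by
  have h1 := mul_le_mul_of_nonneg_right (cast_offset_le hη i) (show 0 ≤ 2 / L by positivity)
  refine h1.trans (le_of_eq ?_)
  field_simp

/-- Offsets are multiples of the short length `2/L`, so within a period the half-open short
intervals do not overlap. As no offset exceeds `d/(Lη)`, the period minus `2/L`, different periods
do not interfere either. -/
theorem disjoint_shortSet (hL : 0 < L) (hη : 0 < η) (j : Fin d)
    {i i' : Fin (offsetMax d η + 1)} (hi : i ≠ i') :
    Disjoint (shortSet d L η j i) (shortSet d L η j i') := by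
  rw [Set.disjoint_left]
  intro x hx hx'
  obtain ⟨k, h1, h2⟩ := exists_mem_short_of_mem_shortSet hL hη hx
  obtain ⟨k', h1', h2'⟩ := exists_mem_short_of_mem_shortSet hL hη hx'
  have ho := offset_mul_le hL hη i
  have ho' := offset_mul_le hL hη i'
  have hL2 : 0 < 2 / L := by positivity
  have hP : 0 < 2 / L + d / (L * η) := by positivity
  have hnn : 0 ≤ ((i : ℕ) : ℝ) * (2 / L) := by positivity
  have hnn' : 0 ≤ ((i' : ℕ) : ℝ) * (2 / L) := by positivity
  rcases lt_trichotomy k k' with h | h | h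
  · have h3 : (k + 1 : ℝ) ≤ k' := by exact_mod_cast h
    have := mul_le_mul_of_nonneg_right h3 hP.le
    linarith
  · subst h
    rcases lt_or_gt_of_ne (fun h => hi (Fin.ext h) : (i : ℕ) ≠ i') with h | h
    · have h3 : ((i : ℕ) + 1 : ℝ) ≤ (i' : ℕ) := by exact_mod_cast h
      have := mul_le_mul_of_nonneg_right h3 hL2.le
      linarith
    · have h3 : ((i' : ℕ) + 1 : ℝ) ≤ (i : ℕ) := by exact_mod_cast h
      have := mul_le_mul_of_nonneg_right h3 hL2.le
      linarith
  · have h3 : (k' + 1 : ℝ) ≤ k := by exact_mod_cast h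
    have := mul_le_mul_of_nonneg_right h3 hP.le
    linarith

/-- The law of the offsets. -/
noncomputable def offsetLaw (d : ℕ) (η : ℝ) : Measure (Offset d η) :=
  Measure.pi fun _ : Fin d => (PMF.uniformOfFintype (Fin (offsetMax d η + 1))).toMeasure

instance : IsProbabilityMeasure (offsetLaw d η) := by
  unfold offsetLaw
  infer_instance

/-- The labelled points that lie in no long box. -/
def outside (L : ℝ) (o : Offset d η) : Set (Cube d × unitInterval) :=
  {p | ∀ J, p.1 ∉ longBox L η o J}

theorem outside_subset (o : Offset d η) :
    outside L o ⊆ ⋃ j, Prod.fst ⁻¹' shortSet d L η j (o j) := by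
  intro p hp
  by_contra h
  simp only [Set.mem_iUnion, Set.mem_preimage, shortSet, Set.mem_ofPred_eq, not_exists,
    not_forall, not_not] at h
  choose J hJ using h
  exact hp J hJ

/-- On one axis the short sets of all offsets have total mass at most `1`, so their average is at
most one over the number of offsets, which exceeds `d/(2η)`. The union bound over `d` axes gives
`2η`. -/
theorem lintegral_outside_le (hL : 0 < L) (hη : 0 < η)
    (D : Measure (Cube d × unitInterval)) [IsProbabilityMeasure D] :
    ∫⁻ o, D (outside L o) ∂(offsetLaw d η) ≤ ENNReal.ofReal (2 * η) := by
  have h1 : ∀ j : Fin d, ∫⁻ o, D (Prod.fst ⁻¹' shortSet d L η j (o j)) ∂(offsetLaw d η) ≤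
      ((offsetMax d η + 1 : ℕ) : ℝ≥0∞)⁻¹ := by
    intro j
    have hmp := measurePreserving_eval
      (fun _ : Fin d => (PMF.uniformOfFintype (Fin (offsetMax d η + 1))).toMeasure) j
    have h2 : ∫⁻ o, D (Prod.fst ⁻¹' shortSet d L η j (o j)) ∂(offsetLaw d η) =
        ∫⁻ i : Fin (offsetMax d η + 1), D (Prod.fst ⁻¹' shortSet d L η j i)
          ∂(PMF.uniformOfFintype (Fin (offsetMax d η + 1))).toMeasure :=
      hmp.lintegral_comp (f := fun i => D (Prod.fst ⁻¹' shortSet d L η j i))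
        (measurable_of_finite _)
    rw [h2, lintegral_fintype]
    simp only [PMF.toMeasure_apply_singleton _ _ (measurableSet_singleton _),
      PMF.uniformOfFintype_apply, Fintype.card_fin]
    rw [← Finset.sum_mul]
    refine mul_le_of_le_one_left zero_le ?_
    rw [← tsum_fintype (L := .unconditional _), ← measure_iUnion]
    · exact prob_le_one
    · exact fun i i' h => (disjoint_shortSet hL hη j h).preimage _
    · exact fun i => measurable_fst (measurableSet_shortSet j i)
  calc _ ≤ ∫⁻ o, ∑ j, D (Prod.fst ⁻¹' shortSet d L η j (o j)) ∂(offsetLaw d η) :=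
        lintegral_mono fun o => (measure_mono (outside_subset o)).trans
          (measure_iUnion_fintype_le _ _)
    _ = ∑ j, ∫⁻ o, D (Prod.fst ⁻¹' shortSet d L η j (o j)) ∂(offsetLaw d η) :=
        lintegral_finsetSum _ fun j _ => measurable_of_finite _
    _ ≤ ∑ _j : Fin d, ((offsetMax d η + 1 : ℕ) : ℝ≥0∞)⁻¹ := Finset.sum_le_sum fun j _ => h1 j
    _ ≤ ENNReal.ofReal (2 * η) := by
        have h3 : (d : ℝ) / (2 * η) < (offsetMax d η + 1 : ℕ) := by
          push_cast
          exact Nat.lt_floor_add_one _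
        rw [Finset.sum_const, Finset.card_univ, Fintype.card_fin, nsmul_eq_mul, ← div_eq_mul_inv,
          ← ENNReal.ofReal_natCast, ← ENNReal.ofReal_natCast,
          ← ENNReal.ofReal_div_of_pos (by positivity)]
        refine ENNReal.ofReal_le_ofReal ?_
        rw [div_le_iff₀ (by positivity)]
        rw [div_lt_iff₀ (by positivity)] at h3
        linarith

end Offsets

/-! ### Excess error of the query answers. -/

section Excess

variable {d : ℕ} {L η : ℝ}

/-- The cell of side `δ` of the grid anchored at the lower corner of the long box `J`. -/
noncomputable def gridCell (L η : ℝ) (o : Offset d η) (J : Fin d → ℕ) (δ : ℝ) (G : ℕ)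
    (x : Cube d) : Fin d → Fin (G + 1) :=
  fun j => Fin.ofNat (G + 1) ⌊((x j : ℝ) - breakpoint d L η (o j) (2 * J j)) / δ⌋₊

theorem measurable_gridCell (o : Offset d η) (J : Fin d → ℕ) (δ : ℝ) (G : ℕ) :
    Measurable (gridCell L η o J δ G) := by
  refine measurable_pi_lambda _ fun j => measurable_from_nat.comp (Nat.measurable_floor.comp ?_)
  exact ((measurable_subtype_coe.comp (measurable_pi_apply j)).sub_const _).div_const _

theorem sub_breakpoint_le (hL : 0 < L) (hη : 0 < η) {o : Offset d η} {J : Fin d → ℕ}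
    {x : Cube d} (hx : x ∈ longBox L η o J) (j : Fin d) :
    (x j : ℝ) - breakpoint d L η (o j) (2 * J j) ≤ min 1 (d / (L * η)) := by
  refine le_min ?_ ?_
  · have h1 : breakpoint d L η (o j) 0 ≤ breakpoint d L η (o j) (2 * J j) :=
      breakpoint_mono hL hη _ (Nat.zero_le _)
    have h2 : breakpoint d L η (o j) 0 = 0 := by rw [breakpoint]
    linarith [(x j).2.2]
  · have h1 := (hx j).2
    -- The first long interval has the offset as its length, which is also at most `d/(Lη)`.
    rcases Nat.eq_zero_or_pos (J j) with h | h
    · have h2 := offset_mul_le hL hη (o j)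
      rw [h] at h1 ⊢
      simp only [breakpoint] at h1 ⊢
      linarith
    · obtain ⟨n, hn⟩ : ∃ n, J j = n + 1 := ⟨J j - 1, by omega⟩
      rw [hn, show 2 * (n + 1) + 1 = 2 * n + 3 by ring, breakpoint_odd_succ] at h1
      rw [hn, show 2 * (n + 1) = 2 * n + 2 by ring]
      linarith

theorem dist_le_of_gridCell_eq (hL : 0 < L) (hη : 0 < η) {o : Offset d η} {J : Fin d → ℕ}
    {δ : ℝ} (hδ : 0 < δ) {G : ℕ} (hG : ⌊min 1 (d / (L * η)) / δ⌋₊ ≤ G) {x x' : Cube d}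
    (hx : x ∈ longBox L η o J) (hx' : x' ∈ longBox L η o J)
    (h : gridCell L η o J δ G x = gridCell L η o J δ G x') : dist x x' ≤ δ := by
  refine (dist_pi_le_iff hδ.le).2 fun j => ?_
  have hj := congrArg Fin.val (congrFun h j)
  -- Within the long box the reduction modulo `G + 1` in `Fin.ofNat` changes nothing.
  have hlt : ∀ {y : Cube d}, y ∈ longBox L η o J →
      ⌊((y j : ℝ) - breakpoint d L η (o j) (2 * J j)) / δ⌋₊ < G + 1 := fun hy =>
    Nat.lt_succ_of_le ((Nat.floor_le_floor (div_le_div_of_nonneg_right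
      (sub_breakpoint_le hL hη hy j) hδ.le)).trans hG)
  simp only [gridCell, Fin.val_ofNat, Nat.mod_eq_of_lt (hlt hx), Nat.mod_eq_of_lt (hlt hx')] at hj
  have h0 : ∀ {y : Cube d}, y ∈ longBox L η o J →
      0 ≤ ((y j : ℝ) - breakpoint d L η (o j) (2 * J j)) / δ := fun hy =>
    div_nonneg (sub_nonneg.2 (hy j).1) hδ.le
  have h1 := Nat.floor_le (h0 hx)
  have h2 := Nat.lt_floor_add_one (((x j : ℝ) - breakpoint d L η (o j) (2 * J j)) / δ)
  have h3 := Nat.floor_le (h0 hx')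
  have h4 := Nat.lt_floor_add_one (((x' j : ℝ) - breakpoint d L η (o j) (2 * J j)) / δ)
  rw [hj] at h1 h2
  rw [Subtype.dist_eq, Real.dist_eq]
  have e : (x j : ℝ) - x' j = (((x j : ℝ) - breakpoint d L η (o j) (2 * J j)) / δ -
      ((x' j : ℝ) - breakpoint d L η (o j) (2 * J j)) / δ) * δ := by
    field_simp
    ring
  rw [e, abs_mul, abs_of_pos hδ]
  refine mul_le_of_le_one_left hδ.le ?_
  rw [abs_le]
  constructor <;> linarith

theorem measurable_of_mem_lipClass {f : Cube d → ℝ} (hL : 0 ≤ L) (hf : f ∈ lipClass d L) :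
    Measurable f := by
  have : LipschitzWith L.toNNReal f := LipschitzWith.of_dist_le_mul fun x y => by
    rw [Real.coe_toNNReal _ hL, Real.dist_eq]
    exact hf.2 x y
  exact this.continuous.measurable

/-- The labelled points whose first component lies in the long box `J`. -/
def labelledBox (L : ℝ) (o : Offset d η) (J : Fin d → ℕ) : Set (Cube d × unitInterval) :=
  Prod.fst ⁻¹' longBox L η o J

theorem measurableSet_labelledBox (o : Offset d η) (J : Fin d → ℕ) :
    MeasurableSet (labelledBox L o J) :=
  measurable_fst (measurableSet_longBox o J)

theorem disjoint_labelledBox (hL : 0 < L) (hη : 0 < η) (o : Offset d η) {J J' : Fin d → ℕ}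
    (h : J ≠ J') : Disjoint (labelledBox L o J) (labelledBox L o J') := by
  refine Disjoint.preimage _ (Set.disjoint_left.2 fun x hx hx' => h ?_)
  exact eq_of_mem_longBox_of_mem_extBox hL hη hx (longBox_subset_extBox hL o J' hx')

theorem pairwise_disjoint_labelledBox (hL : 0 < L) (hη : 0 < η) (o : Offset d η) (K : ℕ) :
    Pairwise (Function.onFun Disjoint
      fun J : Fin d → Fin K => labelledBox L o fun j => (J j : ℕ)) := by
  intro J J' h
  refine disjoint_labelledBox hL hη o fun h' => h ?_
  funext j
  exact Fin.ext (congrFun h' j)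

theorem empErr_boxData {M : ℕ} (N : ℕ) (o : Offset d η) (z : Fin M → Cube d × unitInterval)
    (J : Fin d → ℕ) (f : Cube d → ℝ) :
    empErr (boxData L η N o (fun i => (z i).1) (fun i => (z i).2) J) f =
      ∑ i ∈ firstHits (labelledBox L o J) N z, |((z i).2 : ℝ) - f (z i).1| := by
  rw [empErr, boxData, Multiset.map_map]
  rfl

/-- The approximation error of the absolute loss by its discretization. -/
noncomputable def discretizationError (L δ : ℝ) (T : ℕ) : ℝ := L * δ + 2 / T

/-- A bound on the excess error in the long box `J`. -/
noncomputable def boxExcessBound {M : ℕ} (L : ℝ) (D : Measure (Cube d × unitInterval))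
    (o : Offset d η) (J : Fin d → ℕ) (N T : ℕ) (δ : ℝ) (G : ℕ)
    (z : Fin M → Cube d × unitInterval) : ℝ :=
  excessBound D (labelledBox L o J) N T (discretizationError L δ T)
    (fun p => gridCell L η o J δ G p.1) (fun p => ⌊T * (p.2 : ℝ)⌋₊) z

variable (D : Measure (Cube d × unitInterval))

theorem measurable_label_level (d T : ℕ) :
    Measurable fun p : Cube d × unitInterval => ⌊T * (p.2 : ℝ)⌋₊ :=
  Nat.measurable_floor.comp ((measurable_subtype_coe.comp measurable_snd).const_mul _)

theorem measurableSet_gridCell_preimage (o : Offset d η) (J : Fin d → ℕ) (δ : ℝ) (G : ℕ)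
    (c : Fin d → Fin (G + 1)) :
    MeasurableSet ((fun p : Cube d × unitInterval => gridCell L η o J δ G p.1) ⁻¹' {c}) :=
  ((measurable_gridCell o J δ G).comp measurable_fst) (measurableSet_singleton c)

theorem discretizationError_nonneg {δ : ℝ} (hL : 0 < L) (hδ : 0 < δ) (T : ℕ) :
    0 ≤ discretizationError L δ T := by
  unfold discretizationError
  positivity

theorem boxExcessBound_nonneg {M : ℕ} (hL : 0 < L) {δ : ℝ} (hδ : 0 < δ) (o : Offset d η)
    (J : Fin d → ℕ) (N T G : ℕ) (z : Fin M → Cube d × unitInterval) :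
    0 ≤ boxExcessBound L D o J N T δ G z :=
  excessBound_nonneg D _ N T (discretizationError_nonneg hL hδ T) _ _ z

theorem measurable_boxExcessBound {M : ℕ} (o : Offset d η) (J : Fin d → ℕ) (N T : ℕ) (δ : ℝ)
    (G : ℕ) : Measurable (boxExcessBound (M := M) L D o J N T δ G) :=
  measurable_excessBound D (measurableSet_labelledBox o J) N T _
    (measurableSet_gridCell_preimage o J δ G) (measurable_label_level d T)

/-- A bound on the excess error of the answers of the query algorithm. -/
noncomputable def totalExcessBound {M : ℕ} (L : ℝ) (K N T : ℕ) (δ : ℝ) (G : ℕ)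
    (ω : Offset d η × (Fin M → Cube d × unitInterval)) : ℝ :=
  D.real (outside L ω.1) +
    ∑ J : Fin d → Fin K, boxExcessBound L D ω.1 (fun j => J j) N T δ G ω.2

theorem measurable_totalExcessBound {M : ℕ} (K N T : ℕ) (δ : ℝ) (G : ℕ) :
    Measurable (totalExcessBound (M := M) (η := η) D L K N T δ G) := by
  refine measurable_from_prod_countable_right fun o => ?_
  have h (J : Fin d → Fin K) := measurable_boxExcessBound (M := M) (L := L) D o
    (fun j => (J j : ℕ)) N T δ G
  have h' := (Finset.measurable_fun_sum Finset.univ fun J _ => h J).const_add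
    (D.real (outside L o))
  exact h'

variable [IsProbabilityMeasure D]

theorem abs_label_sub_mem_Icc {f : Cube d → ℝ} (hf : ∀ x, f x ∈ Set.Icc (0 : ℝ) 1)
    (p : Cube d × unitInterval) : |(p.2 : ℝ) - f p.1| ∈ Set.Icc (0 : ℝ) 1 := by
  have h1 := hf p.1
  have h2 := p.2.2
  refine ⟨abs_nonneg _, abs_le.2 ⟨?_, ?_⟩⟩ <;> linarith [h1.1, h1.2, h2.1, h2.2]

theorem measurable_loss {f : Cube d → ℝ} (hL : 0 ≤ L) (hf : f ∈ lipClass d L) :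
    Measurable fun p : Cube d × unitInterval => |(p.2 : ℝ) - f p.1| :=
  ((measurable_subtype_coe.comp measurable_snd).sub
    ((measurable_of_mem_lipClass hL hf).comp measurable_fst)).abs

theorem integrable_loss {f : Cube d → ℝ} (hL : 0 ≤ L) (hf : f ∈ lipClass d L) :
    Integrable (fun p : Cube d × unitInterval => |(p.2 : ℝ) - f p.1|) D :=
  integrable_of_abs_le (measurable_loss hL hf) 1 fun p => by
    rw [abs_abs]
    exact (abs_label_sub_mem_Icc hf.1 p).2

theorem setIntegral_labelledBox_sub_le (hL : 0 < L) (hη : 0 < η) {M N T : ℕ} (hM : 0 < M)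
    (hN : 0 < N) (hT : 0 < T) {δ : ℝ} (hδ : 0 < δ) {G : ℕ}
    (hG : ⌊min 1 (d / (L * η)) / δ⌋₊ ≤ G) (o : Offset d η) (J : Fin d → ℕ)
    (z : Fin M → Cube d × unitInterval) {f g : Cube d → ℝ}
    (hf : IsERM L (boxData L η N o (fun i => (z i).1) (fun i => (z i).2) J) f)
    (hg : g ∈ lipClass d L) :
    ∫ p in labelledBox L o J, |(p.2 : ℝ) - f p.1| ∂D -
      ∫ p in labelledBox L o J, |(p.2 : ℝ) - g p.1| ∂D ≤ boxExcessBound L D o J N T δ G z := by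
  -- A null box has no conditional mean, but its integrals vanish.
  rcases (measureReal_nonneg (μ := D) (s := labelledBox L o J)).eq_or_lt with hp | hp
  · have h0 : D (labelledBox L o J) = 0 := by
      rwa [eq_comm, measureReal_eq_zero_iff] at hp
    rw [setIntegral_measure_zero _ h0, setIntegral_measure_zero _ h0, sub_zero]
    exact boxExcessBound_nonneg D hL hδ o J N T G z
  · have hfg := hf.2 g hg
    rw [empErr_boxData, empErr_boxData] at hfg
    have hdev : ∀ {h : Cube d → ℝ}, h ∈ lipClass d L →
        |deviation D (labelledBox L o J) N (fun p => |(p.2 : ℝ) - h p.1|) z| ≤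
        cellDeviation D (labelledBox L o J) N T (fun p => gridCell L η o J δ G p.1)
          (fun p => ⌊T * (p.2 : ℝ)⌋₊) z +
        2 * discretizationError L δ T * (firstHits (labelledBox L o J) N z).card := by
      intro h hh
      refine abs_deviation_le_cellDeviation D hp N hT (measurableSet_gridCell_preimage o J δ G)
        (measurable_subtype_coe.comp measurable_snd)
        ((measurable_of_mem_lipClass hL.le hh).comp measurable_fst) (fun p => p.2.2)
        (fun p => hh.1 p.1) (fun p hp p' hp' hpp' => ?_) z
      refine (hh.2 p.1 p'.1).trans ?_
      gcongr
      exact dist_le_of_gridCell_eq hL hη hδ hG hp hp' hpp'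
    exact setIntegral_sub_le D hM hN (measurable_loss hL.le hf.1) (measurable_loss hL.le hg)
      (abs_label_sub_mem_Icc hf.1.1) (abs_label_sub_mem_Icc hg.1) z hfg
      (cellDeviation_nonneg D _ N T _ _ z) (discretizationError_nonneg hL hδ T) hp
      (hdev hf.1) (hdev hg)

theorem boxIndex_lt (hL : 0 < L) (hη : 0 < η) (hd : 0 < d) {o : Offset d η} {J : Fin d → ℕ}
    (hJ : IsBoxIndex L η o J) (j : Fin d) : J j < ⌊L * η / d⌋₊ + 2 := by
  rcases Nat.eq_zero_or_pos (J j) with h | h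
  · omega
  · obtain ⟨n, hn⟩ : ∃ n, J j = n + 1 := ⟨J j - 1, by omega⟩
    have h1 := hJ j
    rw [hn, show 2 * (n + 1) = 2 * n + 2 by ring, breakpoint_even] at h1
    have hd' : (0 : ℝ) < d := by exact_mod_cast hd
    have h2 : 0 ≤ ((o j : ℕ) : ℝ) * (2 / L) := by positivity
    have h3 : 0 < 2 / L := by positivity
    have h4 : 0 ≤ (n : ℝ) * (2 / L) := by positivity
    have h5 : (n : ℝ) * (d / (L * η)) ≤ 1 := by
      rw [mul_add] at h1
      linarith
    have h6 : (n : ℝ) ≤ L * η / d := by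
      rw [le_div_iff₀ hd']
      rwa [mul_div_assoc', div_le_one (by positivity)] at h5
    have := Nat.le_floor h6
    omega

/-- The right side contains neither `A` nor `g`: this permits the infimum over `g` and an event
valid for all choices. -/
theorem err_query_sub_err_le (hL : 0 < L) (hη : 0 < η) (hd : 0 < d) {M N T : ℕ} (hM : 0 < M)
    (hN : 0 < N) (hT : 0 < T) {δ : ℝ} (hδ : 0 < δ) {G : ℕ}
    (hG : ⌊min 1 (d / (L * η)) / δ⌋₊ ≤ G) {K : ℕ} (hK : ⌊L * η / d⌋₊ + 2 ≤ K)
    (ω : Offset d η × (Fin M → Cube d × unitInterval)) (A : Choices d L η) {g : Cube d → ℝ}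
    (hg : g ∈ lipClass d L) :
    err D (query A N ω.1 (fun i => (ω.2 i).1) (fun i => (ω.2 i).2)) - err D g ≤
      totalExcessBound D L K N T δ G ω := by
  obtain ⟨o, z⟩ := ω
  set f := query A N o (fun i => (z i).1) (fun i => (z i).2) with hf
  have hfL : f ∈ lipClass d L := query_mem_lipClass hL hη A N o _ _
  set U : Set (Cube d × unitInterval) := ⋃ J : Fin d → Fin K, labelledBox L o fun j => J j
    with hU
  have hUm : MeasurableSet U := MeasurableSet.iUnion fun J => measurableSet_labelledBox o _
  have hdisj : Pairwise (Function.onFun Disjoint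
      fun J : Fin d → Fin K => labelledBox L o fun j => (J j : ℕ)) :=
    pairwise_disjoint_labelledBox hL hη o K
  have hout : Uᶜ ⊆ outside L o := by
    intro p hp J hJ
    have hJK : ∀ j, J j < K := fun j =>
      (boxIndex_lt hL hη hd (isBoxIndex_of_mem_longBox hJ) j).trans_le hK
    exact hp (Set.mem_iUnion.2 ⟨fun j => ⟨J j, hJK j⟩, hJ⟩)
  have hsplit : ∀ {h : Cube d → ℝ}, h ∈ lipClass d L → err D h =
      ∑ J : Fin d → Fin K, ∫ p in labelledBox L o fun j => (J j : ℕ), |(p.2 : ℝ) - h p.1| ∂D +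
        ∫ p in Uᶜ, |(p.2 : ℝ) - h p.1| ∂D := by
    intro h hh
    have hi := integrable_loss D hL.le hh
    rw [err, ← integral_add_compl hUm hi, hU, integral_iUnion_fintype
      (fun J => measurableSet_labelledBox o _) hdisj fun J => hi.integrableOn]
  have h1 : ∫ p in Uᶜ, |(p.2 : ℝ) - f p.1| ∂D ≤ D.real (outside L o) := by
    refine le_trans ?_ (measureReal_mono hout)
    refine (integral_mono (integrable_loss D hL.le hfL).restrict (integrable_const 1)
      fun p => (abs_label_sub_mem_Icc hfL.1 p).2).trans ?_
    simp
  have h2 : 0 ≤ ∫ p in Uᶜ, |(p.2 : ℝ) - g p.1| ∂D := integral_nonneg fun p => abs_nonneg _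
  have h3 : ∀ J : Fin d → ℕ,
      ∫ p in labelledBox L o J, |(p.2 : ℝ) - f p.1| ∂D -
        ∫ p in labelledBox L o J, |(p.2 : ℝ) - g p.1| ∂D ≤
      boxExcessBound L D o J N T δ G z := by
    intro J
    rw [setIntegral_congr_fun (g := fun p => |(p.2 : ℝ) -
      A.erm (boxData L η N o (fun i => (z i).1) (fun i => (z i).2) J) p.1|)
      (measurableSet_labelledBox o J)]
    · exact setIntegral_labelledBox_sub_le D hL hη hM hN hT hδ hG o J z (A.erm_spec _) hg
    · intro p hp
      simp only [hf]
      rw [query_of_mem_longBox hL hη A hp]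
  rw [hsplit hfL, hsplit hg, totalExcessBound]
  have h4 := Finset.sum_le_sum fun (J : Fin d → Fin K) (_ : J ∈ Finset.univ) => h3 fun j => J j
  rw [Finset.sum_sub_distrib] at h4
  linarith

theorem err_query_sub_errOpt_le (hL : 0 < L) (hη : 0 < η) (hd : 0 < d) {M N T : ℕ} (hM : 0 < M)
    (hN : 0 < N) (hT : 0 < T) {δ : ℝ} (hδ : 0 < δ) {G : ℕ}
    (hG : ⌊min 1 (d / (L * η)) / δ⌋₊ ≤ G) {K : ℕ} (hK : ⌊L * η / d⌋₊ + 2 ≤ K)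
    (ω : Offset d η × (Fin M → Cube d × unitInterval)) (A : Choices d L η) :
    err D (query A N ω.1 (fun i => (ω.2 i).1) (fun i => (ω.2 i).2)) - errOpt D L ≤
      totalExcessBound D L K N T δ G ω := by
  rw [sub_le_comm]
  refine le_csInf ⟨_, _, zero_mem_lipClass hL.le, rfl⟩ ?_
  rintro _ ⟨g, hg, rfl⟩
  linarith [err_query_sub_err_le D hL hη hd hM hN hT hδ hG hK ω A hg]

theorem lintegral_totalExcessBound_le (hL : 0 < L) (hη : 0 < η) {M N T : ℕ} (hM : 0 < M)
    (hN : 0 < N) (hT : 0 < T) {δ : ℝ} (hδ : 0 < δ) (G K : ℕ) :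
    ∫⁻ ω, ENNReal.ofReal (totalExcessBound D L K N T δ G ω) ∂(runLaw η M D) ≤
      ENNReal.ofReal (2 * η + (4 * discretizationError L δ T + 4 * √((G + 1 : ℝ) ^ d / N) +
        (4 * √((G + 1 : ℝ) ^ d / M) + √(1 / M)) * √((K : ℝ) ^ d))) := by
  set R := 4 * discretizationError L δ T + 4 * √((G + 1 : ℝ) ^ d / N) +
    (4 * √((G + 1 : ℝ) ^ d / M) + √(1 / M)) * √((K : ℝ) ^ d) with hR
  have hR0 : 0 ≤ R := by
    have := discretizationError_nonneg hL hδ T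
    positivity
  have hlaw : runLaw η M D = (offsetLaw d η).prod (Measure.pi fun _ : Fin M => D) := rfl
  rw [hlaw, lintegral_prod _
    (measurable_totalExcessBound D K N T δ G).ennreal_ofReal.aemeasurable]
  have h1 : ∀ o : Offset d η, ∫⁻ z, ENNReal.ofReal (totalExcessBound D L K N T δ G (o, z))
      ∂(Measure.pi fun _ : Fin M => D) ≤ D (outside L o) + ENNReal.ofReal R := by
    intro o
    have hi : ∀ J : Fin d → Fin K, Integrable
        (fun z => boxExcessBound L D o (fun j => J j) N T δ G z)
        (Measure.pi fun _ : Fin M => D) := fun J =>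
      integrable_excessBound D (measurableSet_labelledBox o _) N T _
        (measurableSet_gridCell_preimage o _ δ G) (measurable_label_level d T)
    have hdisj : Pairwise (Function.onFun Disjoint
        fun J : Fin d → Fin K => labelledBox L o fun j => (J j : ℕ)) :=
      pairwise_disjoint_labelledBox hL hη o K
    have hsum := sum_integral_excessBound_le (M := M) D
      (fun J : Fin d → Fin K => measurableSet_labelledBox (L := L) o fun j => (J j : ℕ))
      hdisj hM hN hT
      (discretizationError_nonneg hL hδ T)
      (fun J : Fin d → Fin K => measurableSet_gridCell_preimage (L := L) o (fun j => (J j : ℕ)) δ G)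
      (measurable_label_level d T)
    simp only [Fintype.card_fun, Fintype.card_fin, Nat.cast_pow, Nat.cast_add, Nat.cast_one]
      at hsum
    have h2 : ∫ z, ∑ J : Fin d → Fin K, boxExcessBound L D o (fun j => J j) N T δ G z
        ∂(Measure.pi fun _ : Fin M => D) ≤ R := by
      rw [integral_finsetSum _ fun J _ => hi J]
      exact hsum
    have h3 : ∀ z : Fin M → Cube d × unitInterval,
        ENNReal.ofReal (totalExcessBound D L K N T δ G (o, z)) = D (outside L o) +
          ENNReal.ofReal (∑ J : Fin d → Fin K, boxExcessBound L D o (fun j => J j) N T δ G z) := by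
      intro z
      rw [totalExcessBound, ENNReal.ofReal_add measureReal_nonneg
        (Finset.sum_nonneg fun J _ => boxExcessBound_nonneg D hL hδ o _ N T G z),
        ofReal_measureReal]
    simp_rw [h3]
    rw [lintegral_add_left measurable_const, lintegral_const, measure_univ, mul_one,
      ← ofReal_integral_eq_lintegral_ofReal (integrable_finsetSum _ fun J _ => hi J)
        (Filter.Eventually.of_forall fun z => Finset.sum_nonneg fun J _ =>
          boxExcessBound_nonneg D hL hδ o _ N T G z)]
    gcongr
  calc _ ≤ ∫⁻ o, (D (outside L o) + ENNReal.ofReal R) ∂(offsetLaw d η) := lintegral_mono h1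
    _ = ∫⁻ o, D (outside L o) ∂(offsetLaw d η) + ENNReal.ofReal R := by
        rw [lintegral_add_right _ measurable_const, lintegral_const, measure_univ, mul_one]
    _ ≤ ENNReal.ofReal (2 * η) + ENNReal.ofReal R := by
        gcongr
        exact lintegral_outside_le hL hη D
    _ = _ := (ENNReal.ofReal_add (by positivity) hR0).symm

end Excess

/-! ### Choice of constants. -/

section Parameters

/-- The logarithmic factor is used only through this positive lower bound, whence constants
depending on `ε₀`. -/
theorem one_sub_le_log_one_div {ε ε₀ : ℝ} (hε : 0 < ε) (h : ε ≤ ε₀) :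
    1 - ε₀ ≤ Real.log (1 / ε) := by
  rw [one_div, Real.log_inv]
  linarith [Real.log_le_sub_one_of_pos hε]

/-- The factor `2` pays for rounding down. -/
theorem div_floor_le {a x ε : ℝ} (ha : 1 ≤ a) (hε : 0 < ε) (hε1 : ε ≤ 1)
    (hx : 2 * 128 ^ 2 * a / ε ^ 2 ≤ x) : 0 < ⌊x⌋₊ ∧ a / ⌊x⌋₊ ≤ (ε / 128) ^ 2 := by
  have hε2 : ε ^ 2 ≤ 1 := pow_le_one₀ hε.le hε1
  have h1 : 2 * 128 ^ 2 * a ≤ x * ε ^ 2 := (div_le_iff₀ (by positivity)).1 hx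
  have hx0 : 0 ≤ x := le_trans (by positivity) hx
  have h2 : 2 * 128 ^ 2 ≤ x := by nlinarith
  have h3 := Nat.lt_floor_add_one x
  have h4 : x / 2 ≤ ⌊x⌋₊ := by linarith
  have h5 : (0 : ℝ) < ⌊x⌋₊ := by linarith
  refine ⟨by exact_mod_cast h5, ?_⟩
  rw [div_le_iff₀ h5]
  nlinarith [mul_le_mul_of_nonneg_left h4 (sq_nonneg ε)]

theorem mul_pow_le_mul_mul_pow {B A b u : ℝ} {d : ℕ} (hd : 1 ≤ d) (hB : 1 ≤ B) (ha : 0 ≤ A)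
    (hb : 0 ≤ b) (hu : 0 ≤ u) : B * A ^ d * u * b ≤ (B * A) ^ d * u * b := by
  rw [mul_pow]
  have : B ≤ B ^ d := le_self_pow₀ hB (by omega)
  gcongr

theorem le_labelBound {ε ε₀ a : ℝ} {d : ℕ} (hd : 1 ≤ d) (hε : 0 < ε) (hε₀ : ε ≤ ε₀)
    (h1 : ε₀ < 1) (ha0 : 0 ≤ a) (ha : a ≤ 4097 * d / ε ^ 2) :
    2 * 128 ^ 2 * a ^ d / ε ^ 2 ≤ labelBound (2 * 128 ^ 2 / (1 - ε₀) * 4097) d ε := by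
  have hl := one_sub_le_log_one_div hε hε₀
  have hl0 : 0 < 1 - ε₀ := by linarith
  set B : ℝ := 2 * 128 ^ 2 / (1 - ε₀) with hB
  have hB1 : 1 ≤ B := by
    rw [hB, one_le_div hl0]
    linarith
  have hBl : 2 * 128 ^ 2 = B * (1 - ε₀) := by
    rw [hB]
    field_simp
  unfold labelBound
  calc 2 * 128 ^ 2 * a ^ d / ε ^ 2 ≤ 2 * 128 ^ 2 * (4097 * d / ε ^ 2) ^ d / ε ^ 2 := by gcongr
    _ = B * (4097 * d / ε ^ 2) ^ d * (1 / ε ^ 2) * (1 - ε₀) := by rw [hBl]; ring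
    _ ≤ (B * (4097 * d / ε ^ 2)) ^ d * (1 / ε ^ 2) * (1 - ε₀) :=
        mul_pow_le_mul_mul_pow hd hB1 (by positivity) hl0.le (by positivity)
    _ ≤ (B * (4097 * d / ε ^ 2)) ^ d * (1 / ε ^ 2) * Real.log (1 / ε) := by gcongr
    _ = 1 / ε ^ 2 * (B * 4097 * d / ε ^ 2) ^ d * Real.log (1 / ε) := by
        rw [show B * (4097 * d / ε ^ 2) = B * 4097 * d / ε ^ 2 by ring]
        ring

theorem le_poolBound {ε ε₀ a L : ℝ} {d : ℕ} (hd : 1 ≤ d) (hL : 0 < L) (hε : 0 < ε)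
    (hε₀ : ε ≤ ε₀) (h1 : ε₀ < 1) (ha0 : 0 ≤ a) (ha : a ≤ 387 * L / ε) :
    2 * 128 ^ 2 * a ^ d / ε ^ 2 ≤ poolBound (2 * 128 ^ 2 / (1 - ε₀) * 387) d L ε := by
  have hl := one_sub_le_log_one_div hε hε₀
  have hl0 : 0 < 1 - ε₀ := by linarith
  set B : ℝ := 2 * 128 ^ 2 / (1 - ε₀) with hB
  have hB1 : 1 ≤ B := by
    rw [hB, one_le_div hl0]
    linarith
  have hBl : 2 * 128 ^ 2 = B * (1 - ε₀) := by
    rw [hB]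
    field_simp
  have h3 : 1 / ε ^ 2 ≤ 1 / ε ^ 3 :=
    one_div_le_one_div_of_le (by positivity)
      (pow_le_pow_of_le_one hε.le (hε₀.trans h1.le) (by norm_num))
  unfold poolBound
  calc 2 * 128 ^ 2 * a ^ d / ε ^ 2 ≤ 2 * 128 ^ 2 * (387 * L / ε) ^ d / ε ^ 2 := by gcongr
    _ = B * (387 * L / ε) ^ d * (1 / ε ^ 2) * (1 - ε₀) := by rw [hBl]; ring
    _ ≤ (B * (387 * L / ε)) ^ d * (1 / ε ^ 2) * (1 - ε₀) :=
        mul_pow_le_mul_mul_pow hd hB1 (by positivity) hl0.le (by positivity)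
    _ ≤ (B * (387 * L / ε)) ^ d * (1 / ε ^ 3) * Real.log (1 / ε) := by gcongr
    _ = (B * 387 * L / ε) ^ d * (1 / ε ^ 3) * Real.log (1 / ε) := by
        rw [show B * (387 * L / ε) = B * 387 * L / ε by ring]

theorem sqrt_le_of_le_sq {a ε : ℝ} (hε : 0 < ε) (h : a ≤ (ε / 128) ^ 2) : √a ≤ ε / 128 :=
  (Real.sqrt_le_left (by positivity)).2 h

/-- The parameters of the analysis: the number `T` of levels, the side `δ` of the cells, their
number `G + 1` along an axis and the number `K` of long intervals along an axis. -/
theorem exists_parameters {d M N : ℕ} {L ε ε₀ : ℝ} (hd : 1 ≤ d) (hε : 0 < ε) (hε₀ : ε ≤ ε₀)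
    (h1 : ε₀ < 1) (hL : ε ≤ L)
    (hM : M = ⌊poolBound (2 * 128 ^ 2 / (1 - ε₀) * 387) d L ε⌋₊)
    (hN : N = ⌊labelBound (2 * 128 ^ 2 / (1 - ε₀) * 4097) d ε⌋₊) :
    0 < M ∧ 0 < N ∧ ∃ (T G K : ℕ) (δ : ℝ), 0 < T ∧ 0 < δ ∧
      ⌊min 1 (d / (L * (1 / 32 * ε))) / δ⌋₊ ≤ G ∧ ⌊L * (1 / 32 * ε) / d⌋₊ + 2 ≤ K ∧
      2 * (1 / 32 * ε) + (4 * discretizationError L δ T + 4 * √((G + 1 : ℝ) ^ d / N) +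
        (4 * √((G + 1 : ℝ) ^ d / M) + √(1 / M)) * √((K : ℝ) ^ d)) ≤ ε / 4 := by
  have hL0 : 0 < L := hε.trans_le hL
  have hε1 : ε < 1 := hε₀.trans_lt h1
  have hd0 : (1 : ℝ) ≤ d := by exact_mod_cast hd
  have hdp : (0 : ℝ) < d := by linarith
  have hLε : 1 ≤ L / ε := (one_le_div hε).2 hL
  set η := 1 / 32 * ε with hη
  have hη0 : 0 < η := by positivity
  set δ := ε / (128 * L) with hδ
  have hδ0 : 0 < δ := by positivity
  set s := min 1 (d / (L * η)) with hs
  have hs0 : 0 ≤ s := by positivity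
  have hs1 : s ≤ 1 := min_le_left _ _
  have hs2 : s ≤ d / (L * η) := min_le_right _ _
  set G := ⌊s / δ⌋₊ with hG
  set K := ⌊L * η / d⌋₊ + 2 with hK
  have hG1 : (G : ℝ) ≤ s / δ := Nat.floor_le (by positivity)
  have hK1 : (K : ℝ) ≤ L * η / d + 2 := by
    rw [hK]
    push_cast
    linarith [Nat.floor_le (show 0 ≤ L * η / d by positivity)]
  have hsδ : s / δ = s * (128 * (L / ε)) := by
    rw [hδ]
    field_simp
  have hε2 : ε ^ 2 ≤ 1 := pow_le_one₀ hε.le hε1.le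
  -- `4096` is `32 * 128`, from `η` and `δ`; the extra cell adds one more `d / ε ^ 2`.
  have hGd : (G + 1 : ℝ) ≤ 4097 * d / ε ^ 2 := by
    have e1 : s / δ ≤ d / (L * η) / δ := by gcongr
    have e2 : d / (L * η) / δ = 4096 * d / ε ^ 2 := by
      rw [hδ, hη]
      field_simp
      norm_num
    have e3 : 1 ≤ d / ε ^ 2 := by
      rw [one_le_div (by positivity)]
      linarith
    have e4 : 4097 * d / ε ^ 2 = 4096 * d / ε ^ 2 + d / ε ^ 2 := by ring
    linarith
  -- Cells per axis over all boxes. Box length times number of boxes is at most `1 + 2`, thanks to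
  -- the cap `s ≤ 1`; hence `387 = 3 * 128 + 1 + 2`.
  have hKG : (G + 1 : ℝ) * K ≤ 387 * L / ε := by
    have e1 : s * (L * η / d) ≤ 1 := by
      calc s * (L * η / d) ≤ d / (L * η) * (L * η / d) := by gcongr
        _ = 1 := by field_simp
    have e2 : L * η / d ≤ L / ε := by
      rw [div_le_div_iff₀ hdp hε, mul_assoc]
      refine mul_le_mul_of_nonneg_left ?_ hL0.le
      rw [hη]
      nlinarith
    have e3 : (G + 1 : ℝ) * K ≤ (s * (128 * (L / ε)) + 1) * (L * η / d + 2) := by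
      rw [← hsδ]
      gcongr
    have e4 : (s * (128 * (L / ε)) + 1) * (L * η / d + 2) =
        128 * (L / ε) * (s * (L * η / d) + 2 * s) + L * η / d + 2 := by ring
    have e5 : 128 * (L / ε) * (s * (L * η / d) + 2 * s) ≤ 128 * (L / ε) * 3 := by
      gcongr
      linarith
    have e6 : 387 * L / ε = 387 * (L / ε) := by ring
    rw [e6]
    linarith
  have hG0 : (1 : ℝ) ≤ G + 1 := by linarith [(Nat.cast_nonneg G : (0 : ℝ) ≤ G)]
  have hK0 : (1 : ℝ) ≤ K := by
    rw [hK]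
    push_cast
    linarith [(Nat.cast_nonneg ⌊L * η / d⌋₊ : (0 : ℝ) ≤ _)]
  have hNb := div_floor_le (one_le_pow₀ hG0 (n := d)) hε hε1.le
    (le_labelBound hd hε hε₀ h1 (by positivity) hGd)
  have hMb := div_floor_le (one_le_pow₀ (one_le_mul_of_one_le_of_one_le hG0 hK0) (n := d)) hε
    hε1.le (le_poolBound hd hL0 hε hε₀ h1 (by positivity) hKG)
  rw [← hN] at hNb
  rw [← hM] at hMb
  have hMp : (0 : ℝ) < M := by exact_mod_cast hMb.1
  set T := ⌈256 / ε⌉₊ with hT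
  have hT1 : 256 / ε ≤ T := Nat.le_ceil _
  have hT0 : (0 : ℝ) < T := lt_of_lt_of_le (by positivity) hT1
  refine ⟨hMb.1, hNb.1, T, G, K, δ, by exact_mod_cast hT0, hδ0, le_rfl, le_rfl, ?_⟩
  have b1 : discretizationError L δ T ≤ ε / 64 := by
    unfold discretizationError
    have e1 : L * δ = ε / 128 := by
      rw [hδ]
      field_simp
    have e2 : 2 / (T : ℝ) ≤ ε / 128 := by
      rw [div_le_iff₀ hε] at hT1
      rw [div_le_div_iff₀ hT0 (by norm_num)]
      linarith
    linarith
  have b2 := sqrt_le_of_le_sq hε hNb.2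
  have b3 : √((G + 1 : ℝ) ^ d / M) * √((K : ℝ) ^ d) ≤ ε / 128 := by
    rw [← Real.sqrt_mul (by positivity)]
    refine sqrt_le_of_le_sq hε (le_trans (le_of_eq ?_) hMb.2)
    rw [mul_pow]
    ring
  have b4 : √(1 / (M : ℝ)) * √((K : ℝ) ^ d) ≤ ε / 128 := by
    refine le_trans ?_ b3
    gcongr
    exact one_le_pow₀ hG0
  -- The budget is `ε/16 + ε/16 + ε/32 + ε/32 + ε/128`, below `ε/4`.
  rw [add_mul, mul_assoc 4]
  linarith

end Parameters

/-! ### The good event, by Markov's inequality. -/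

section Main

theorem exists_good_event {d : ℕ} {L η ε : ℝ} (hL : 0 < L) (hη : 0 < η) (hd : 0 < d)
    (hε : 0 < ε) {M N T G K : ℕ} {δ : ℝ} (hM : 0 < M) (hN : 0 < N) (hT : 0 < T) (hδ : 0 < δ)
    (hG : ⌊min 1 (d / (L * η)) / δ⌋₊ ≤ G) (hK : ⌊L * η / d⌋₊ + 2 ≤ K)
    (hb : 2 * η + (4 * discretizationError L δ T + 4 * √((G + 1 : ℝ) ^ d / N) +
        (4 * √((G + 1 : ℝ) ^ d / M) + √(1 / M)) * √((K : ℝ) ^ d)) ≤ ε / 4)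
    (D : Measure (Cube d × unitInterval)) [IsProbabilityMeasure D] :
    ∃ E : Set (Offset d η × (Fin M → Cube d × unitInterval)),
      MeasurableSet E ∧ 1 / 2 < runLaw η M D E ∧
        ∀ ω ∈ E, ∀ A : Choices d L η,
          err D (query A N ω.1 (fun i => (ω.2 i).1) (fun i => (ω.2 i).2)) - errOpt D L ≤ ε := by
  have hX := measurable_totalExcessBound (M := M) (η := η) (L := L) D K N T δ G
  have : IsProbabilityMeasure (runLaw η M D) :=
    inferInstanceAs (IsProbabilityMeasure ((offsetLaw d η).prod (Measure.pi fun _ : Fin M => D)))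
  -- Defining the event through the bound makes it measurable and independent of the choices; the
  -- actual error need not be measurable in `ω`.
  refine ⟨{ω | totalExcessBound D L K N T δ G ω < ε}, measurableSet_lt hX measurable_const, ?_,
    fun ω hω A => (err_query_sub_errOpt_le D hL hη hd hM hN hT hδ hG hK ω A).trans (le_of_lt hω)⟩
  have hmarkov := meas_ge_le_lintegral_div (μ := runLaw η M D) hX.ennreal_ofReal.aemeasurable
    (ENNReal.ofReal_pos.2 hε).ne' ENNReal.ofReal_ne_top
  have hint := (lintegral_totalExcessBound_le D hL hη hM hN hT hδ G K).trans
    (ENNReal.ofReal_le_ofReal hb)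
  have hbad : runLaw η M D {ω | totalExcessBound D L K N T δ G ω < ε}ᶜ ≤
      ENNReal.ofReal (1 / 4) := by
    calc _ ≤ runLaw η M D {ω | ENNReal.ofReal ε ≤
          ENNReal.ofReal (totalExcessBound D L K N T δ G ω)} :=
          measure_mono fun ω hω => ENNReal.ofReal_le_ofReal (not_lt.1 hω)
      _ ≤ _ := hmarkov
      _ ≤ ENNReal.ofReal (ε / 4) / ENNReal.ofReal ε := by gcongr
      _ = ENNReal.ofReal (1 / 4) := by
          rw [← ENNReal.ofReal_div_of_pos hε]
          congr 1
          field_simp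
  rw [prob_compl_eq_one_sub (measurableSet_lt hX measurable_const)] at hbad
  by_contra hc
  have h1 : (1 : ℝ≥0∞) ≤ ENNReal.ofReal (1 / 4) + 1 / 2 :=
    (tsub_le_iff_right.1 hbad).trans (by gcongr; exact not_lt.1 hc)
  have h2 : ENNReal.ofReal (1 / 4) + 1 / 2 = ENNReal.ofReal (3 / 4) := by
    rw [show (1 / 2 : ℝ≥0∞) = ENNReal.ofReal (1 / 2) by
      rw [ENNReal.ofReal_div_of_pos two_pos]; simp,
      ← ENNReal.ofReal_add (by norm_num) (by norm_num)]
    norm_num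
  rw [h2, ENNReal.one_le_ofReal] at h1
  norm_num at h1

end Main

end LocalLipschitz

theorem mainTheorem3 :
    ∃ c : ℝ, 0 < c ∧ c ≤ 1 ∧ ∀ ε₀ : ℝ, ε₀ < 1 → ∃ C₁ C₂ : ℝ, 0 < C₁ ∧ 0 < C₂ ∧
      ∀ (d : ℕ) (L ε : ℝ), 1 ≤ d → 0 < ε → ε ≤ ε₀ → ε ≤ L →
        ∀ M N : ℕ, M = ⌊poolBound C₁ d L ε⌋₊ → N = ⌊labelBound C₂ d ε⌋₊ →
          Nonempty (Choices d L (c * ε)) ∧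
          -- every query asks for few labels, and its answer depends on no other label
          (∀ (o : Offset d (c * ε)) (xs : Fin M → Cube d) (x : Cube d),
            ((labelQueries L (c * ε) N o xs x).card : ℝ) ≤ labelBound C₂ d ε ∧
            ∀ (A : Choices d L (c * ε)) (ys ys' : Fin M → unitInterval),
              (∀ i ∈ labelQueries L (c * ε) N o xs x, ys i = ys' i) →
                query A N o xs ys x = query A N o xs ys' x) ∧
          -- the answers form a function in the class, near-optimal with probability > 1/2
          ∀ (D : MeasureTheory.Measure (Cube d × unitInterval)),
            MeasureTheory.IsProbabilityMeasure D →
            ∃ E : Set (Offset d (c * ε) × (Fin M → Cube d × unitInterval)),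
              MeasurableSet E ∧ 1 / 2 < runLaw (c * ε) M D E ∧
              ∀ (ω : Offset d (c * ε) × (Fin M → Cube d × unitInterval))
                (A : Choices d L (c * ε)),
                ∃ f ∈ lipClass d L,
                  (∀ x, query A N ω.1 (fun i => (ω.2 i).1) (fun i => (ω.2 i).2) x = f x) ∧
                  (ω ∈ E → err D f - errOpt D L ≤ ε) := by
  refine ⟨1 / 32, by norm_num, by norm_num, fun ε₀ h1 => ⟨2 * 128 ^ 2 / (1 - ε₀) * 387,
    2 * 128 ^ 2 / (1 - ε₀) * 4097, ?_, ?_, fun d L ε hd hε hε₀ hL M N hM hN => ?_⟩⟩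
  · have : 0 < 1 - ε₀ := by linarith
    positivity
  · have : 0 < 1 - ε₀ := by linarith
    positivity
  have hL0 : 0 < L := hε.trans_le hL
  have hη : 0 < 1 / 32 * ε := by positivity
  obtain ⟨hM0, hN0, T, G, K, δ, hT, hδ, hG, hK, hb⟩ :=
    exists_parameters hd hε hε₀ h1 hL hM hN
  refine ⟨nonempty_choices hL0, fun o xs x => ⟨?_, fun A ys ys' h => query_congr A h⟩,
    fun D hD => ?_⟩
  -- Since `N` is positive, the real bound is positive and its floor does not exceed it.
  · refine le_trans ?_ (Nat.floor_le (Nat.pos_of_floor_pos (hN ▸ hN0)).le)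
    rw [← hN]
    exact_mod_cast card_labelQueries_le N o xs x
  · obtain ⟨E, hE, hEp, hEerr⟩ := exists_good_event hL0 hη hd hε hM0 hN0 hT hδ hG hK hb D
    exact ⟨E, hE, hEp, fun ω A => ⟨_, query_mem_lipClass hL0 hη A N ω.1 _ _, fun _ => rfl,
      fun hω => hEerr ω hω A⟩⟩
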